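/- Setting. Records are triples (user, group, other information), with infinitely many potential users and a (possibly infinite) set of groups $G_i$. A dataset $X$ is a finite set of records in which each user has at most one record per group and contributes to at most $C_u\ge 1$ groups; there are at least $C_u$ groups. Two datasets are neighbors if one arises from the other by adding records of one individual. Let $C(X,G_i)$ be the number of records of $X$ in $G_i$, and let $A(X,G_i)\in\mathbb R^{m-1}$ ($m\ge 1$) be an arbitrary function of the records of $X$ in group $G_i$ (absent if $m=1$). Let $\tau\ge 1$ be an integer, $\tau^*>\tau$ real, $\sigma>0$, and $\Sigma\in\mathbb R^{(m-1)\times(m-1)}$ positive definite. The Gaussian sparse histogram mechanism outputs independent rows: row $i$ is $(C(X,G_i)+v_i,\ A(X,G_i)+m_i)$ if $C(X,G_i)\ge\tau$ and $C(X,G_i)+v_i\ge\tau^*$, and is null otherwise, where $v_i\sim N(0,\sigma^2)$ and $m_i\sim N(0,\Sigma)$ are independent. The sensitivity $\mu_o\ge 0$ of $A$ is given by $$\mu_o^2=\max_{i,\ X,X'\text{ neighbors}}(A(X,G_i)-A(X',G_i))^T\Sigma^{-1}(A(X,G_i)-A(X',G_i)),$$ with $\mu_o=0$ if $m=1$. A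 mechanism $M$ is $(\epsilon,\delta)$-DP, $\delta\in[0,1]$, if $P(M(X)\in E)\le e^\epsilon P(M(X')\in E)+\delta$ for all neighbors $X,X'$ and all measurable $E$. Let $\Phi$ be the standard normal CDF, $\Phi_0=\Phi\left(\frac{\tau^*-\tau}{\sigma}\right)$, $\mu(a)=\sqrt{a/\sigma^2+a\mu_o^2}$, $f(\mu,\epsilon)=\Phi\left(\frac{\mu}{2}-\frac{\epsilon}{\mu}\right)-e^{\epsilon}\Phi\left(-\frac{\mu}{2}-\frac{\epsilon}{\mu}\right)$, and $$\delta_{\text{Gaussian}}=f(\mu(C_u),\epsilon),\qquad \delta_{\text{infinite}}=1-\Phi_0^{C_u}.$$ Corollary. Fix $\epsilon\ge 0$, all the parameters above and $\mu_o\ge 0$ (with $\mu_o=0$ if $m=1$). The mechanism has a minimal $\delta$ at $\epsilon$, that is, a smallest $\delta\in[0,1]$ such that the mechanism is $(\epsilon,\delta)$-DP for every aggregation function $A$ of sensitivity $\mu_o$. It is given by $$\delta=\max\Big[\,1-\Phi_0^{C_u},\ \max_{a_++a_==C_u,\ a_+>0}\big(1-\Phi_0^{a_=}+\Phi_0^{a_=}f(\mu(a_+),\epsilon-a_=\log\Phi_0)\big),\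 \max_{a_++a_==C_u,\ a_+>0}f(\mu(a_+),\epsilon+a_=\log\Phi_0)\Big],$$ where $a_+,a_=$ range over non-negative integers, and it satisfies $$\max(\delta_{\text{infinite}},\delta_{\text{Gaussian}})\le\delta<\delta_{\text{infinite}}+\delta_{\text{Gaussian}}.$$ If $C_u=1$, then $\delta=\max(\delta_{\text{infinite}},\delta_{\text{Gaussian}})$. -/

import Mathlib

open MeasureTheory ProbabilityTheory

namespace GSHM

noncomputable section

/-- A record `(user, group, other information)`. -/
@[ext]
structure Record (U G O : Type*) where
  user : U
  group : G
  info : O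

/-- A dataset: a finite set of records in which a user has at most one record per group and
contributes to at most `Cu` groups. -/
structure Dataset (U G O : Type*) (Cu : ℕ) where
  records : Finset (Record U G O)
  one_per_group : ∀ r ∈ records, ∀ s ∈ records, r.user = s.user → r.group = s.group → r = s
  bounded : ∀ u : U, {g : G | ∃ r ∈ records, r.user = u ∧ r.group = g}.ncard ≤ Cu

/-- `X'` is obtained from `X` by adding records of one individual. -/
def AddsOneUser {U G O : Type*} {Cu : ℕ} (X X' : Dataset U G O Cu) : Prop :=
  X.records ⊆ X'.records ∧ ∃ u : U, ∀ r ∈ X'.records, r ∉ X.records → r.user = u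

/-- Neighbouring datasets: one arises from the other by adding records of one individual. -/
def Neighbors {U G O : Type*} {Cu : ℕ} (X X' : Dataset U G O Cu) : Prop :=
  AddsOneUser X X' ∨ AddsOneUser X' X

open Classical in
/-- The records of `X` that belong to group `g`. -/
def Dataset.inGroup {U G O : Type*} {Cu : ℕ} (X : Dataset U G O Cu) (g : G) :
    Finset (Record U G O) :=
  X.records.filter (fun r => r.group = g)

/-- The number of records of `X` in group `g`. -/
def Dataset.count {U G O : Type*} {Cu : ℕ} (X : Dataset U G O Cu) (g : G) : ℕ :=
  (X.inGroup g).card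

/-- An aggregation function: `k` real statistics of the records of each group. -/
abbrev Aggregation (U G O : Type*) (k : ℕ) : Type _ :=
  G → Finset (Record U G O) → EuclideanSpace ℝ (Fin k)

/-- One row of the output, with `k + 1` columns: `Sum.inl ()` is the null row (nothing is
released for this group), and `Sum.inr (c, a)` is a released row with noisy count `c` and noisy
aggregates `a`. -/
abbrev Row (k : ℕ) : Type := Unit ⊕ (ℝ × EuclideanSpace ℝ (Fin k))

/-- The law of the noise `(v, m)` of one row: independent `v ∼ N(0, σ²)` and `m ∼ N(0, S)`. -/
def rowNoise (σ : ℝ) {k : ℕ} (S : Matrix (Fin k) (Fin k) ℝ) :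
    Measure (ℝ × EuclideanSpace ℝ (Fin k)) :=
  (gaussianReal 0 (Real.toNNReal (σ ^ 2))).prod (multivariateGaussian 0 S)

/-- A row of the output, as a function of the count `c` and the aggregates `a` of the group and
of the noise `w = (v, m)`: it is released if `τ ≤ c` and `τ* ≤ c + v`. -/
def row {k : ℕ} (τ : ℕ) (τs : ℝ) (c : ℕ) (a : EuclideanSpace ℝ (Fin k))
    (w : ℝ × EuclideanSpace ℝ (Fin k)) : Row k :=
  if τ ≤ c ∧ τs ≤ (c : ℝ) + w.1 then Sum.inr ((c : ℝ) + w.1, a + w.2) else Sum.inl ()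

/-- The Gaussian sparse histogram mechanism: the law of its output on the dataset `X`, the rows
being independent. -/
def mechanism {U G O : Type*} {Cu k : ℕ} (τ : ℕ) (τs σ : ℝ) (S : Matrix (Fin k) (Fin k) ℝ)
    (A : Aggregation U G O k) (X : Dataset U G O Cu) : Measure (G → Row k) :=
  Measure.infinitePi fun g => (rowNoise σ S).map (row τ τs (X.count g) (A g (X.inGroup g)))

/-- `(ε, δ)`-differential privacy of a randomized mechanism given by its output laws. -/
def IsDP {U G O Ω : Type*} [MeasurableSpace Ω] {Cu : ℕ} (ε δ : ℝ)
    (M : Dataset U G O Cu → Measure Ω) : Prop :=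
  δ ∈ Set.Icc (0 : ℝ) 1 ∧ ∀ X X' : Dataset U G O Cu, Neighbors X X' →
    ∀ E : Set Ω, MeasurableSet E → (M X).real E ≤ Real.exp ε * (M X').real E + δ

/-- `μ₀` is the sensitivity of the aggregation function `A` (per group, relative to the noise
covariance `S`): `μ₀ ≥ 0` and `μ₀²` is the maximum of
`(A(X, g) - A(X', g))ᵀ S⁻¹ (A(X, g) - A(X', g))` over all groups `g` and neighbours `X, X'`. -/
def HasSensitivity {U G O : Type*} (Cu : ℕ) {k : ℕ} (S : Matrix (Fin k) (Fin k) ℝ)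
    (A : Aggregation U G O k) (μ₀ : ℝ) : Prop :=
  0 ≤ μ₀ ∧ IsGreatest {q : ℝ | ∃ (g : G) (X X' : Dataset U G O Cu), Neighbors X X' ∧
    q = dotProduct (A g (X.inGroup g) - A g (X'.inGroup g)).ofLp
      (S⁻¹.mulVec (A g (X.inGroup g) - A g (X'.inGroup g)).ofLp)} (μ₀ ^ 2)

/-- The cumulative distribution function of the standard normal distribution. -/
def Phi (x : ℝ) : ℝ := cdf (gaussianReal 0 1) x

/-- The analytic Gaussian expression `f(μ, ε)`. -/
def f (μ ε : ℝ) : ℝ := Phi (μ / 2 - ε / μ) - Real.exp ε * Phi (-μ / 2 - ε / μ)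

/-- `μ(a) = √(a / σ² + a μ₀²)`. -/
def mu (σ μ₀ : ℝ) (a : ℕ) : ℝ := Real.sqrt (a / σ ^ 2 + a * μ₀ ^ 2)

/-- `δ_Gaussian = f(μ(Cu), ε)`. -/
def deltaGaussian (σ μ₀ : ℝ) (Cu : ℕ) (ε : ℝ) : ℝ := f (mu σ μ₀ Cu) ε

/-- `δ_infinite = 1 - Φ((τ* - τ) / σ) ^ Cu`. -/
def deltaInfinite (τ : ℕ) (τs σ : ℝ) (Cu : ℕ) : ℝ := 1 - Phi ((τs - τ) / σ) ^ Cu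

/-- `ε₂(a) = ε - a log Φ((τ* - τ) / σ)`. -/
def eps2 (τ : ℕ) (τs σ ε : ℝ) (a : ℕ) : ℝ := ε - a * Real.log (Phi ((τs - τ) / σ))

/-- `ε₃(a) = ε + a log Φ((τ* - τ) / σ)`. -/
def eps3 (τ : ℕ) (τs σ ε : ℝ) (a : ℕ) : ℝ := ε + a * Real.log (Phi ((τs - τ) / σ))

/-- The quantities of which the exact `δ` is the maximum: `δ_infinite`, and two families indexed
by the pairs `(p, e)` with `p + e = Cu` and `p > 0` (the numbers of affected rows with count
above the threshold `τ`, respectively equal to it). -/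
def deltaTerms (τ : ℕ) (τs σ μ₀ : ℝ) (Cu : ℕ) (ε : ℝ) : Set ℝ :=
  {deltaInfinite τ τs σ Cu} ∪
  {t | ∃ p e : ℕ, p + e = Cu ∧ 0 < p ∧
    t = 1 - Phi ((τs - τ) / σ) ^ e +
      Phi ((τs - τ) / σ) ^ e * f (mu σ μ₀ p) (eps2 τ τs σ ε e)} ∪
  {t | ∃ p e : ℕ, p + e = Cu ∧ 0 < p ∧ t = f (mu σ μ₀ p) (eps3 τ τs σ ε e)}

theorem measurable_row {k : ℕ} (τ : ℕ) (τs : ℝ) (c : ℕ) (a : EuclideanSpace ℝ (Fin k)) :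
    Measurable (row τ τs c a) := by
  unfold row
  refine Measurable.ite ?_ ?_ measurable_const
  · by_cases h : τ ≤ c
    · simp only [h, true_and]
      exact measurableSet_le measurable_const (by fun_prop)
    · simp [h]
  · exact measurable_inr.comp (by fun_prop)

instance isProbabilityMeasure_rowNoise (σ : ℝ) {k : ℕ} (S : Matrix (Fin k) (Fin k) ℝ) :
    IsProbabilityMeasure (rowNoise σ S) := by
  unfold rowNoise
  infer_instance

/-- The law of each row is a probability measure, so that the product measure in `mechanism` is
the genuine one. -/
instance isProbabilityMeasure_rowLaw (σ : ℝ) {k : ℕ} (S : Matrix (Fin k) (Fin k) ℝ)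
    (τ : ℕ) (τs : ℝ) (c : ℕ) (a : EuclideanSpace ℝ (Fin k)) :
    IsProbabilityMeasure ((rowNoise σ S).map (row τ τs c a)) :=
  Measure.isProbabilityMeasure_map (measurable_row τ τs c a).aemeasurable

end

end GSHM

namespace GSHM

/-! Let `X'` arise from `X` by adding records of one individual. In every affected group the count
grows by exactly one, so the affected rows are of three kinds: those with count at least `τ` already
in `X` (the set `F`), those with count `τ - 1` in `X` (the set `H`, with `e` elements), and those
null under both datasets. On `F` the change of dataset is a shift of the Gaussian noise followed by
one fixed post-processing; on `H` a surely null row becomes null with probability `r = Phi ((τs - τ)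
/ σ)`.

For the upper bound, let an intermediate law follow `X'` on `F` and `X` elsewhere. It differs from
the law of `X` by a Gaussian shift of squared norm at most `|F| (1 / σ ^ 2 + μ₀ ^ 2)`, which costs
`f` (`hockeyStickLE_infinitePi_rows`); and `r ^ e` times it lies below the law of `X'`
(`smul_infinitePi_le`). The factor `r ^ e` is absorbed into `ε`, giving `eps3` in one direction and,
through complements, `eps2` in the other (`mechanism_real_le`).

For the lower bound, a fixed vector is summed over the records of each group (`sumAggregation`). The
rows of `F` get `n` records and those of `H` get `τ - 1`. As `n → ∞` the rows of `F` are almost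
surely released, so privacy yields inequalities about the bare Gaussian shift
(`IsDP.gaussian_rows`); optimal half-space events turn them into the terms of `deltaTerms`.

Shifts of a Gaussian measure are reduced to dimension one by characteristic functions
(`CameronMartin.map_prod_eq`), where the Neyman–Pearson half-line gives `f` exactly. The comparison
with `deltaInfinite + deltaGaussian` rests on the monotonicity of `f` and on `f_add_log_le`. -/

/-- `P E ≤ exp ε * Q E + δ` for all events `E`: the hockey-stick divergence of `P` from `Q` at
`exp ε` is at most `δ`. -/
def HockeyStickLE {Ω : Type*} [MeasurableSpace Ω] (P Q : Measure Ω) (ε δ : ℝ) : Prop :=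
  ∀ E : Set Ω, MeasurableSet E → P E ≤ ENNReal.ofReal (Real.exp ε) * Q E + ENNReal.ofReal δ

/-! ### The standard normal distribution function. -/

section StandardNormal

theorem continuous_gaussianPDFReal (m : ℝ) (v : NNReal) : Continuous (gaussianPDFReal m v) := by
  rw [gaussianPDFReal_def]
  fun_prop

theorem Phi_eq_real (x : ℝ) : Phi x = (gaussianReal 0 1).real (Set.Iic x) := cdf_eq_real _ x

theorem gaussianReal_real_eq_integral (m : ℝ) (s : Set ℝ) :
    (gaussianReal m 1).real s = ∫ x in s, gaussianPDFReal m 1 x := by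
  rw [measureReal_def, gaussianReal_apply_eq_integral m one_ne_zero, ENNReal.toReal_ofReal]
  exact integral_nonneg fun x => gaussianPDFReal_nonneg _ _ _

theorem Phi_eq_integral (x : ℝ) : Phi x = ∫ y in Set.Iic x, gaussianPDFReal 0 1 y := by
  rw [Phi_eq_real, gaussianReal_real_eq_integral]

theorem hasDerivAt_Phi (x : ℝ) : HasDerivAt Phi (gaussianPDFReal 0 1 x) x := by
  have h : Phi = fun y => Phi 0 + ∫ z in (0 : ℝ)..y, gaussianPDFReal 0 1 z := by
    funext y
    rw [← intervalIntegral.integral_Iic_sub_Iic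
      (integrable_gaussianPDFReal 0 1).integrableOn (integrable_gaussianPDFReal 0 1).integrableOn,
      ← Phi_eq_integral, ← Phi_eq_integral]
    ring
  rw [h]
  exact ((continuous_gaussianPDFReal 0 1).integral_hasStrictDerivAt 0 x).hasDerivAt.const_add _

theorem Phi_strictMono : StrictMono Phi :=
  strictMono_of_deriv_pos fun x => by
    rw [(hasDerivAt_Phi x).deriv]
    exact gaussianPDFReal_pos _ _ _ one_ne_zero

theorem Phi_pos (x : ℝ) : 0 < Phi x :=
  (cdf_nonneg _ (x - 1)).trans_lt (Phi_strictMono (by linarith))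

theorem Phi_lt_one (x : ℝ) : Phi x < 1 :=
  (Phi_strictMono (by linarith : x < x + 1)).trans_le (cdf_le_one _ _)

theorem gaussianReal_real_Ici (m t : ℝ) : (gaussianReal m 1).real (Set.Ici t) = Phi (m - t) := by
  have h := gaussianReal_map_const_sub (μ := 0) (v := 1) m
  rw [sub_zero] at h
  rw [← h, map_measureReal_apply (by fun_prop) measurableSet_Ici, Phi_eq_real]
  congr 1
  ext x
  simp [le_sub_comm]

end StandardNormal

/-! ### The privacy profile `f` of a one-dimensional Gaussian shift, and stability of hockey-stick
bounds. -/

section AnalyticGaussian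

theorem gaussianPDFReal_eq_mul_exp (d x : ℝ) :
    gaussianPDFReal d 1 x = gaussianPDFReal 0 1 x * Real.exp (d * x - d ^ 2 / 2) := by
  simp only [gaussianPDFReal_def]
  rw [mul_assoc _ (Real.exp _) (Real.exp _), ← Real.exp_add]
  congr 2
  simp
  ring

/-- The squares of the two arguments differ by `2 * ε`. This makes the `ε / μ ^ 2` terms cancel in
the derivative of `f`. -/
theorem exp_mul_gaussianPDFReal {μ : ℝ} (hμ : μ ≠ 0) (ε : ℝ) :
    Real.exp ε * gaussianPDFReal 0 1 (-μ / 2 - ε / μ) = gaussianPDFReal 0 1 (μ / 2 - ε / μ) := by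
  simp only [gaussianPDFReal_def]
  rw [mul_left_comm, ← Real.exp_add]
  congr 2
  simp
  field_simp
  ring

theorem hasDerivAt_f {μ : ℝ} (hμ : μ ≠ 0) (ε : ℝ) :
    HasDerivAt (fun m => f m ε) (gaussianPDFReal 0 1 (μ / 2 - ε / μ)) μ := by
  have hinv : HasDerivAt (fun m : ℝ => ε / m) (-(ε / μ ^ 2)) μ := by
    have := (hasDerivAt_inv hμ).const_mul ε
    simpa [div_eq_mul_inv] using this
  have h1 : HasDerivAt (fun m : ℝ => m / 2 - ε / m) (1 / 2 - -(ε / μ ^ 2)) μ :=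
    ((hasDerivAt_id μ).div_const 2).sub hinv
  have h2 : HasDerivAt (fun m : ℝ => -m / 2 - ε / m) (-1 / 2 - -(ε / μ ^ 2)) μ :=
    ((hasDerivAt_id μ).neg.div_const 2).sub hinv
  have h := ((hasDerivAt_Phi _).comp μ h1).sub
    (((hasDerivAt_Phi _).comp μ h2).const_mul (Real.exp ε))
  refine h.congr_deriv ?_
  rw [← mul_assoc, exp_mul_gaussianPDFReal hμ]
  ring

theorem f_strictMonoOn (ε : ℝ) : StrictMonoOn (fun m => f m ε) (Set.Ioi 0) := by
  refine strictMonoOn_of_deriv_pos (convex_Ioi 0)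
    (fun m hm => (hasDerivAt_f (ne_of_gt hm) ε).continuousAt.continuousWithinAt) fun m hm => ?_
  rw [interior_Ioi] at hm
  rw [(hasDerivAt_f (ne_of_gt hm) ε).deriv]
  exact gaussianPDFReal_pos _ _ _ one_ne_zero

/-- For `d > 0` this half-line is where the likelihood ratio of `N(d, 1)` to `N(0, 1)` is at least
`exp ε`, so `f` is the value of the optimal test. -/
theorem f_eq_real {d : ℝ} (ε : ℝ) :
    f d ε = (gaussianReal d 1).real (Set.Ici (d / 2 + ε / d)) -
      Real.exp ε * (gaussianReal 0 1).real (Set.Ici (d / 2 + ε / d)) := by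
  rw [gaussianReal_real_Ici, gaussianReal_real_Ici, f]
  congr 2 <;> ring_nf

/-- Neyman–Pearson: the left side integrates a signed density over `E`, and the half-line of
`f_eq_real` is exactly where that density is nonnegative. -/
theorem gaussianReal_real_sub_le_f {d : ℝ} (hd : 0 < d) (ε : ℝ) {E : Set ℝ}
    (hE : MeasurableSet E) :
    (gaussianReal d 1).real E - Real.exp ε * (gaussianReal 0 1).real E ≤ f d ε := by
  set g : ℝ → ℝ := fun x => gaussianPDFReal d 1 x - Real.exp ε * gaussianPDFReal 0 1 x
  have hint (s : Set ℝ) : (gaussianReal d 1).real s - Real.exp ε * (gaussianReal 0 1).real s =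
      ∫ x in s, g x := by
    rw [gaussianReal_real_eq_integral, gaussianReal_real_eq_integral, ← integral_const_mul,
      ← integral_sub (integrable_gaussianPDFReal d 1).integrableOn
        ((integrable_gaussianPDFReal 0 1).const_mul _).integrableOn]
  have hset : Set.Ici (d / 2 + ε / d) = {x | 0 ≤ g x} := by
    ext x
    simp only [g, Set.mem_Ici, Set.mem_ofPred_eq, gaussianPDFReal_eq_mul_exp d x]
    rw [mul_comm, ← sub_mul, mul_nonneg_iff_of_pos_right (gaussianPDFReal_pos _ _ _ one_ne_zero),
      sub_nonneg, Real.exp_le_exp]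
    have h : d * (d / 2 + ε / d) = d ^ 2 / 2 + ε := by field_simp
    constructor
    · intro hx
      have := mul_le_mul_of_nonneg_left hx hd.le
      linarith
    · intro hx
      refine le_of_mul_le_mul_left ?_ hd
      linarith
  rw [f_eq_real, hint, hint, hset]
  refine setIntegral_le_nonneg hE (Measurable.stronglyMeasurable ?_) ?_
  · exact (measurable_gaussianPDFReal _ _).sub ((measurable_gaussianPDFReal _ _).const_mul _)
  · exact (integrable_gaussianPDFReal _ _).sub ((integrable_gaussianPDFReal _ _).const_mul _)

theorem f_nonneg {d : ℝ} (hd : 0 < d) (ε : ℝ) : 0 ≤ f d ε := by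
  simpa using gaussianReal_real_sub_le_f hd ε MeasurableSet.empty

theorem f_pos {d : ℝ} (hd : 0 < d) (ε : ℝ) : 0 < f d ε :=
  (f_nonneg (half_pos hd) ε).trans_lt
    (f_strictMonoOn ε (Set.mem_Ioi.2 (half_pos hd)) (Set.mem_Ioi.2 hd) (half_lt_self hd))

theorem f_mono_left {d d' : ℝ} (hd : 0 < d) (h : d ≤ d') (ε : ℝ) : f d ε ≤ f d' ε :=
  (f_strictMonoOn ε).monotoneOn (Set.mem_Ioi.2 hd) (Set.mem_Ioi.2 (hd.trans_le h)) h

/-- The event optimal for `ε'` is also a test for `ε`, where it is penalised less. -/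
theorem f_anti_right {d : ℝ} (hd : 0 < d) {ε ε' : ℝ} (h : ε ≤ ε') : f d ε' ≤ f d ε := by
  rw [f_eq_real ε']
  refine le_trans ?_ (gaussianReal_real_sub_le_f hd ε
    (measurableSet_Ici (a := d / 2 + ε' / d)))
  gcongr

theorem f_le_one (d ε : ℝ) : f d ε ≤ 1 := by
  unfold f
  have := mul_pos (Real.exp_pos ε) (Phi_pos (-d / 2 - ε / d))
  linarith [Phi_lt_one (d / 2 - ε / d)]

/-- Multiplying `exp ε` by `r ≤ 1` costs at most `1 - r`. -/
theorem f_add_log_le {d : ℝ} (hd : 0 < d) (ε : ℝ) {r : ℝ} (hr : 0 < r) (hr1 : r ≤ 1) :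
    f d (ε + Real.log r) ≤ 1 - r + f d ε := by
  have hf := f_nonneg hd ε
  rw [f_eq_real (ε + Real.log r)]
  set T := Set.Ici (d / 2 + (ε + Real.log r) / d)
  have h1 := gaussianReal_real_sub_le_f hd ε (E := T) measurableSet_Ici
  have h2 : (gaussianReal d 1).real T ≤ 1 := measureReal_le_one
  rw [Real.exp_add, Real.exp_log hr]
  -- If `exp ε * Q T ≤ 1`, scaling it by `r` loses at most `1 - r`. Otherwise `P T ≤ 1` already
  -- gives `P T - r * exp ε * Q T ≤ 1 - r`.
  rcases le_total (Real.exp ε * (gaussianReal 0 1).real T) 1 with h | h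
  · nlinarith
  · nlinarith

theorem hockeyStickLE_of_real {Ω : Type*} [MeasurableSpace Ω] {P Q : Measure Ω}
    [IsProbabilityMeasure P] [IsProbabilityMeasure Q] {ε δ : ℝ}
    (h : ∀ E, MeasurableSet E → P.real E ≤ Real.exp ε * Q.real E + δ) :
    HockeyStickLE P Q ε δ := by
  intro E hE
  -- The empty event forces `δ ≥ 0`, so `ENNReal.ofReal δ` does not truncate.
  have hδ : 0 ≤ δ := by simpa using h ∅ MeasurableSet.empty
  rw [← ofReal_measureReal (μ := P), ← ofReal_measureReal (μ := Q),
    ← ENNReal.ofReal_mul (Real.exp_pos ε).le, ← ENNReal.ofReal_add (by positivity) hδ]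
  exact ENNReal.ofReal_le_ofReal (h E hE)

theorem HockeyStickLE.real {Ω : Type*} [MeasurableSpace Ω] {P Q : Measure Ω}
    [IsProbabilityMeasure P] [IsProbabilityMeasure Q] {ε δ : ℝ} (hδ : 0 ≤ δ)
    (h : HockeyStickLE P Q ε δ) {E : Set Ω} (hE : MeasurableSet E) :
    P.real E ≤ Real.exp ε * Q.real E + δ := by
  have := h E hE
  rw [← ofReal_measureReal (μ := P), ← ofReal_measureReal (μ := Q),
    ← ENNReal.ofReal_mul (Real.exp_pos ε).le, ← ENNReal.ofReal_add (by positivity) hδ] at this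
  exact (ENNReal.ofReal_le_ofReal_iff (by positivity)).1 this

theorem hockeyStickLE_gaussianReal {d : ℝ} (hd : 0 < d) (ε : ℝ) :
    HockeyStickLE (gaussianReal d 1) (gaussianReal 0 1) ε (f d ε) :=
  hockeyStickLE_of_real fun _ hE => by linarith [gaussianReal_real_sub_le_f hd ε hE]

theorem HockeyStickLE.map {Ω Ω' : Type*} [MeasurableSpace Ω] [MeasurableSpace Ω']
    {P Q : Measure Ω} {ε δ : ℝ} (h : HockeyStickLE P Q ε δ) {g : Ω → Ω'} (hg : Measurable g) :
    HockeyStickLE (P.map g) (Q.map g) ε δ := by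
  intro E hE
  rw [Measure.map_apply hg hE, Measure.map_apply hg hE]
  exact h _ (hg hE)

/-- Fubini: the bound holds on each section, and `ρ` has mass one, so `δ` integrates to itself. -/
theorem HockeyStickLE.prod {Ω Ω' : Type*} [MeasurableSpace Ω] [MeasurableSpace Ω']
    {P Q : Measure Ω} [SFinite P] [SFinite Q] {ε δ : ℝ} (h : HockeyStickLE P Q ε δ)
    (ρ : Measure Ω') [IsProbabilityMeasure ρ] :
    HockeyStickLE (P.prod ρ) (Q.prod ρ) ε δ := by
  intro E hE
  rw [Measure.prod_apply_symm hE, Measure.prod_apply_symm hE,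
    ← lintegral_const_mul _ (measurable_measure_prodMk_right hE)]
  calc ∫⁻ y, P ((fun x => (x, y)) ⁻¹' E) ∂ρ
      ≤ ∫⁻ y, (ENNReal.ofReal (Real.exp ε) * Q ((fun x => (x, y)) ⁻¹' E) + ENNReal.ofReal δ) ∂ρ :=
        lintegral_mono fun y => h _ (measurable_prodMk_right hE)
    _ = _ := by
        rw [lintegral_add_right _ measurable_const]
        simp

end AnalyticGaussian

/-! ### Shifts of a Gaussian measure, reduced to one dimension. -/

section CameronMartin

variable {E : Type*} [NormedAddCommGroup E] [NormedSpace ℝ E] [MeasurableSpace E]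

/-- `ℓ` represents the direction `w` in the centred Gaussian measure `ν`: as characteristic
functions show, `Cov(L, ℓ) = L w` for every continuous linear functional `L`, and `Var ℓ = ℓ w`. -/
def CameronMartin (ν : Measure E) (ℓ : StrongDual ℝ E) (w : E) : Prop :=
  ∀ (L : StrongDual ℝ E) (c : ℝ), charFunDual ν (L + c • ℓ) =
    charFunDual ν L * Complex.exp ((-(c * L w + c ^ 2 * ℓ w / 2) : ℝ))

theorem charFunDual_gaussianReal (m : ℝ) (v : NNReal) (L : StrongDual ℝ ℝ) :
    charFunDual (gaussianReal m v) L =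
      Complex.exp ((L 1 * m : ℝ) * Complex.I - ((v * L 1 ^ 2 / 2 : ℝ) : ℂ)) := by
  have hL : (L : ℝ → ℝ) = fun x => L 1 * x := by
    funext x
    simpa [mul_comm] using L.map_smul x 1
  rw [charFunDual_eq_charFun_map_one, hL, gaussianReal_map_const_mul, charFun_gaussianReal]
  congr 1
  push_cast
  ring_nf

theorem CameronMartin.neg {ν : Measure E} {ℓ : StrongDual ℝ E} {w : E}
    (h : CameronMartin ν ℓ w) : CameronMartin ν (-ℓ) (-w) := by
  intro L c
  have hc : c • -ℓ = (-c) • ℓ := by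
    ext
    simp
  rw [hc, h]
  simp

variable [BorelSpace E]

theorem CameronMartin.map_eq_gaussianReal {ν : Measure E} [IsProbabilityMeasure ν]
    {ℓ : StrongDual ℝ E} {w : E} (h : CameronMartin ν ℓ w) (hw : 0 ≤ ℓ w) :
    ν.map ℓ = gaussianReal 0 (ℓ w).toNNReal := by
  have := Measure.isProbabilityMeasure_map (μ := ν) ℓ.continuous.aemeasurable
  refine Measure.ext_of_charFun ?_
  funext t
  rw [charFun_map_eq_charFunDual_smul, charFun_gaussianReal, ← zero_add (t • ℓ), h]
  have : charFunDual ν 0 = 1 := by simp [charFunDual_apply]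
  rw [this, one_mul]
  congr 1
  simp [hw]
  ring

/-- The bound of `CameronMartin.hockeyStickLE` is attained. -/
theorem CameronMartin.exists_real_sub_eq {ν : Measure E} [IsProbabilityMeasure ν]
    {ℓ : StrongDual ℝ E} {w : E} (h : CameronMartin ν ℓ w) {d : ℝ} (hd : 0 < d)
    (hw : ℓ w = d ^ 2) (ε : ℝ) :
    ∃ T : Set E, MeasurableSet T ∧
      f d ε = ν.real ((fun x => x + w) ⁻¹' T) - Real.exp ε * ν.real T := by
  -- Under `ν` the statistic `ℓ / d` is standard normal, and the shift by `w` adds `ℓ w / d = d` to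
  -- it. The pulled-back optimal half-line is therefore optimal for `ν`.
  have hl : ν.map (fun x => ℓ x / d) = gaussianReal 0 1 := by
    have := h.map_eq_gaussianReal (hw ▸ sq_nonneg d)
    have h2 := gaussianReal_map_div_const (μ := 0) (v := (ℓ w).toNNReal) d
    rw [← this, Measure.map_map (by fun_prop) (by fun_prop)] at h2
    rw [Function.comp_def] at h2
    rw [h2, zero_div]
    congr 1
    ext
    simp [hw, max_eq_left (sq_nonneg d), hd.ne']
  have hm : ν.map (fun x => ℓ x / d + d) = gaussianReal d 1 := by
    have h2 := gaussianReal_map_add_const (μ := 0) (v := 1) d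
    rw [← hl, Measure.map_map (by fun_prop) (by fun_prop), zero_add] at h2
    exact h2
  refine ⟨(fun x => ℓ x / d) ⁻¹' Set.Ici (d / 2 + ε / d),
    measurableSet_Ici.preimage (by fun_prop), ?_⟩
  rw [f_eq_real, ← hl, ← hm, map_measureReal_apply (by fun_prop) measurableSet_Ici,
    map_measureReal_apply (by fun_prop) measurableSet_Ici]
  congr 2
  ext x
  have : d ^ 2 / d = d := by field_simp
  simp [hw, add_div, this]

variable [SecondCountableTopology E] [CompleteSpace E]

/-- The Gaussian measure `ν`, shifted along `w`, is made of a one-dimensional normal variable in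
the direction `w` and an independent remainder. -/
theorem CameronMartin.map_prod_eq {ν : Measure E} [IsProbabilityMeasure ν]
    {ℓ : StrongDual ℝ E} {w : E} (h : CameronMartin ν ℓ w) {d : ℝ} (hd : d ≠ 0)
    (hw : ℓ w = d ^ 2) (m : ℝ) :
    (ν.prod (gaussianReal m 1)).map (fun p : E × ℝ => p.1 - (ℓ p.1 / d ^ 2) • w + (p.2 / d) • w) =
      ν.map (fun x => x + (m / d) • w) := by
  let D : E × ℝ →L[ℝ] E := ContinuousLinearMap.fst ℝ E ℝ -
    (1 / d ^ 2) • (ℓ.comp (ContinuousLinearMap.fst ℝ E ℝ)).smulRight w +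
    (1 / d) • (ContinuousLinearMap.snd ℝ E ℝ).smulRight w
  have hD : (fun p : E × ℝ => p.1 - (ℓ p.1 / d ^ 2) • w + (p.2 / d) • w) = D := by
    funext p
    simp [D, smul_smul, div_eq_inv_mul]
  rw [hD]
  have := Measure.isProbabilityMeasure_map (μ := ν.prod (gaussianReal m 1))
    D.continuous.aemeasurable
  have := Measure.isProbabilityMeasure_map (μ := ν) (f := fun x => x + (m / d) • w)
    (by fun_prop)
  refine Measure.ext_of_charFunDual ?_
  funext L
  rw [charFunDual_map, charFunDual_prod, charFunDual_map_add_const, charFunDual_gaussianReal]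
  -- Removing the component along `w` multiplies the characteristic function by `exp ((L w) ^ 2 / (2
  -- * d ^ 2))`; the fresh normal variable restores this Gaussian factor and leaves only the phase
  -- of the shift.
  have h1 : (L ∘SL D) ∘SL ContinuousLinearMap.inl ℝ E ℝ = L + (-(L w / d ^ 2)) • ℓ := by
    ext x
    simp [D]
    ring
  have h2 : ((L ∘SL D) ∘SL ContinuousLinearMap.inr ℝ E ℝ) 1 = L w / d := by
    simp [D]
    ring
  have hd' : (d : ℂ) ≠ 0 := by exact_mod_cast hd
  rw [h1, h2, h, mul_assoc, ← Complex.exp_add, hw]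
  congr 2
  simp
  field_simp
  ring

/-- Shifting a Gaussian measure along `w` costs as much as shifting a standard normal variable by
the norm `d` of `w`. -/
theorem CameronMartin.hockeyStickLE {ν : Measure E} [IsProbabilityMeasure ν]
    {ℓ : StrongDual ℝ E} {w : E} (h : CameronMartin ν ℓ w) {d : ℝ} (hd : 0 < d)
    (hw : ℓ w = d ^ 2) (ε : ℝ) :
    HockeyStickLE (ν.map (fun x => x + w)) ν ε (f d ε) := by
  have h0 := h.map_prod_eq hd.ne' hw 0
  have hm := h.map_prod_eq hd.ne' hw d
  simp only [zero_div, zero_smul, add_zero, Measure.map_id', div_self hd.ne', one_smul] at h0 hm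
  rw [← hm]
  nth_rewrite 2 [← h0]
  have hs : Measurable (fun p : ℝ × E => p.2 - (ℓ p.2 / d ^ 2) • w + (p.1 / d) • w) := by fun_prop
  have key := ((hockeyStickLE_gaussianReal hd ε).prod ν).map hs
  -- `HockeyStickLE.prod` varies the first factor while `map_prod_eq` has the normal variable
  -- second, hence the swap.
  have hsw (m : ℝ) : ((gaussianReal m 1).prod ν).map
      (fun p : ℝ × E => p.2 - (ℓ p.2 / d ^ 2) • w + (p.1 / d) • w) =
      (ν.prod (gaussianReal m 1)).map
        (fun p : E × ℝ => p.1 - (ℓ p.1 / d ^ 2) • w + (p.2 / d) • w) := by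
    rw [← Measure.prod_swap, Measure.map_map hs measurable_swap]
    rfl
  rwa [hsw, hsw] at key

/-- The shift along `-w` has the same norm; translating both measures by `w` afterwards reverses the
roles. -/
theorem CameronMartin.hockeyStickLE' {ν : Measure E} [IsProbabilityMeasure ν]
    {ℓ : StrongDual ℝ E} {w : E} (h : CameronMartin ν ℓ w) {d : ℝ} (hd : 0 < d)
    (hw : ℓ w = d ^ 2) (ε : ℝ) :
    HockeyStickLE ν (ν.map (fun x => x + w)) ε (f d ε) := by
  have key := (h.neg.hockeyStickLE hd (by simpa using hw) ε).map
    (g := fun x => x + w) (by fun_prop)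
  rw [Measure.map_map (by fun_prop) (by fun_prop)] at key
  simpa [Function.comp_def] using key

end CameronMartin

/-! ### Cameron–Martin functionals of the noise. -/

section CameronMartinInstances

theorem CameronMartin.prod {E F : Type*} [NormedAddCommGroup E] [NormedSpace ℝ E]
    [MeasurableSpace E] [NormedAddCommGroup F] [NormedSpace ℝ F] [MeasurableSpace F]
    {ν : Measure E} {ν' : Measure F} [SFinite ν] [SFinite ν'] {ℓ : StrongDual ℝ E}
    {ℓ' : StrongDual ℝ F} {w : E} {w' : F} (h : CameronMartin ν ℓ w)
    (h' : CameronMartin ν' ℓ' w') :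
    CameronMartin (ν.prod ν') (ℓ.coprod ℓ') (w, w') := by
  intro L c
  have h1 : (L + c • ℓ.coprod ℓ') ∘SL ContinuousLinearMap.inl ℝ E F =
      L ∘SL ContinuousLinearMap.inl ℝ E F + c • ℓ := by
    ext x
    simp
  have h2 : (L + c • ℓ.coprod ℓ') ∘SL ContinuousLinearMap.inr ℝ E F =
      L ∘SL ContinuousLinearMap.inr ℝ E F + c • ℓ' := by
    ext x
    simp
  have h3 : L (w, w') = L (w, 0) + L (0, w') := by
    rw [← map_add]
    simp
  rw [charFunDual_prod, charFunDual_prod, h1, h2, h, h', mul_mul_mul_comm, ← Complex.exp_add]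
  congr 2
  simp [h3]
  ring

theorem CameronMartin.pi {ι : Type*} [Fintype ι] {E : Type*} [NormedAddCommGroup E]
    [NormedSpace ℝ E] [MeasurableSpace E] {ν : Measure E} [SigmaFinite ν]
    {ℓ : ι → StrongDual ℝ E} {w : ι → E} (h : ∀ i, CameronMartin ν (ℓ i) (w i)) :
    CameronMartin (Measure.pi fun _ : ι => ν)
      (∑ i, (ℓ i).comp (ContinuousLinearMap.proj (φ := fun _ : ι => E) i)) w := by
  classical
  intro L c
  have h1 (i : ι) : (L + c • ∑ j, (ℓ j).comp (ContinuousLinearMap.proj (φ := fun _ : ι => E) j)) ∘SL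
      ContinuousLinearMap.single ℝ (fun _ : ι => E) i =
      L ∘SL ContinuousLinearMap.single ℝ (fun _ : ι => E) i + c • ℓ i := by
    ext x
    simp only [ContinuousLinearMap.comp_apply, add_apply,
      smul_apply, sum_apply,
      ContinuousLinearMap.single_apply, ContinuousLinearMap.proj_apply]
    rw [Finset.sum_eq_single i (fun j _ hj => by simp [Pi.single_eq_of_ne hj]) (by simp)]
    simp
  have h3 : L w = ∑ i, L (Pi.single i (w i)) := by
    rw [← map_sum, Finset.univ_sum_single]
  rw [charFunDual_pi, charFunDual_pi]
  simp only [h1, h _ _ _]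
  rw [Finset.prod_mul_distrib, ← Complex.exp_sum]
  congr 2
  rw [← Complex.ofReal_sum]
  congr 1
  simp only [Finset.sum_neg_distrib, Finset.sum_add_distrib, ContinuousLinearMap.comp_apply,
    ContinuousLinearMap.single_apply, sum_apply,
    ContinuousLinearMap.proj_apply, ← Finset.mul_sum, ← Finset.sum_div, h3]

theorem cameronMartin_gaussianReal {v : NNReal} (hv : v ≠ 0) (a : ℝ) :
    CameronMartin (gaussianReal 0 v) ((a / v) • ContinuousLinearMap.id ℝ ℝ) a := by
  intro L c
  have hv' : (v : ℂ) ≠ 0 := by exact_mod_cast hv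
  have hL : L a = a * L 1 := by simpa using L.map_smul a 1
  rw [charFunDual_gaussianReal, charFunDual_gaussianReal, ← Complex.exp_add, hL]
  congr 1
  simp
  field_simp
  ring

/-- With `b = S⁻¹ a` one has `S b = a`, so in the quadratic form of `x + c • b` the cross term pairs
`x` with `a` and the square term pairs `b` with `a`. -/
theorem cameronMartin_multivariateGaussian {k : ℕ} {S : Matrix (Fin k) (Fin k) ℝ} (hS : S.PosDef)
    (a : EuclideanSpace ℝ (Fin k)) :
    CameronMartin (multivariateGaussian 0 S)
      (InnerProductSpace.toDualMap ℝ _ (WithLp.toLp 2 (S⁻¹.mulVec a.ofLp))) a := by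
  intro L c
  obtain ⟨x, rfl⟩ := (InnerProductSpace.toDual ℝ (EuclideanSpace ℝ (Fin k))).surjective L
  set b : EuclideanSpace ℝ (Fin k) := WithLp.toLp 2 (S⁻¹.mulVec a.ofLp) with hb
  have hSb : S.mulVec b.ofLp = a.ofLp := by
    rw [hb, Matrix.mulVec_mulVec, Matrix.mul_nonsing_inv _ hS.det_pos.ne'.isUnit, Matrix.one_mulVec]
  have hsymm (y : Fin k → ℝ) : dotProduct b.ofLp (S.mulVec y) = dotProduct y a.ofLp := by
    rw [Matrix.dotProduct_mulVec, ← Matrix.mulVec_transpose]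
    have : S.transpose = S := by simpa using hS.isHermitian.eq
    rw [this, hSb, dotProduct_comm]
  have h1 : (InnerProductSpace.toDual ℝ (EuclideanSpace ℝ (Fin k))) x +
      c • InnerProductSpace.toDualMap ℝ _ b =
        InnerProductSpace.toDualMap ℝ (EuclideanSpace ℝ (Fin k)) (x + c • b) := by
    ext y
    simp
  have h2 : (InnerProductSpace.toDual ℝ (EuclideanSpace ℝ (Fin k))) x =
      InnerProductSpace.toDualMap ℝ _ x := by
    ext y
    simp
  have h3 (y z : EuclideanSpace ℝ (Fin k)) : inner ℝ y z = dotProduct y.ofLp z.ofLp := by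
    rw [EuclideanSpace.inner_eq_star_dotProduct, dotProduct_comm]
    simp
  rw [h1, h2, ← charFun_eq_charFunDual_toDualMap, ← charFun_eq_charFunDual_toDualMap,
    charFun_multivariateGaussian hS.posSemidef, charFun_multivariateGaussian hS.posSemidef,
    ← Complex.exp_add]
  congr 1
  simp only [InnerProductSpace.toDualMap_apply_apply, h3, WithLp.ofLp_add, WithLp.ofLp_smul,
    Matrix.mulVec_add, Matrix.mulVec_smul, dotProduct_add, add_dotProduct, smul_dotProduct,
    dotProduct_smul, hSb, hsymm]
  simp
  ring

/-- The functional that represents the shift `a` in the noise of one row. -/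
noncomputable def rowDual (σ : ℝ) {k : ℕ} (S : Matrix (Fin k) (Fin k) ℝ)
    (a : ℝ × EuclideanSpace ℝ (Fin k)) : StrongDual ℝ (ℝ × EuclideanSpace ℝ (Fin k)) :=
  ((a.1 / (Real.toNNReal (σ ^ 2) : ℝ)) • ContinuousLinearMap.id ℝ ℝ).coprod
    (InnerProductSpace.toDualMap ℝ _ (WithLp.toLp 2 (S⁻¹.mulVec a.2.ofLp)))

theorem rowDual_apply_self (σ : ℝ) {k : ℕ} (S : Matrix (Fin k) (Fin k) ℝ)
    (a : ℝ × EuclideanSpace ℝ (Fin k)) :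
    rowDual σ S a a = a.1 ^ 2 / σ ^ 2 + dotProduct a.2.ofLp (S⁻¹.mulVec a.2.ofLp) := by
  simp [rowDual, EuclideanSpace.inner_eq_star_dotProduct, max_eq_left (sq_nonneg σ)]
  ring

theorem cameronMartin_rowNoise {σ : ℝ} (hσ : 0 < σ) {k : ℕ} {S : Matrix (Fin k) (Fin k) ℝ}
    (hS : S.PosDef) (a : ℝ × EuclideanSpace ℝ (Fin k)) :
    CameronMartin (rowNoise σ S) (rowDual σ S a) a :=
  (cameronMartin_gaussianReal (by simpa using hσ.ne') a.1).prod
    (cameronMartin_multivariateGaussian hS a.2)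

/-- The functional that represents the shift `a` in the noise of finitely many rows. -/
noncomputable def rowsDual {ι : Type*} [Fintype ι] (σ : ℝ) {k : ℕ} (S : Matrix (Fin k) (Fin k) ℝ)
    (a : ι → ℝ × EuclideanSpace ℝ (Fin k)) :
    StrongDual ℝ (ι → ℝ × EuclideanSpace ℝ (Fin k)) :=
  ∑ i, (rowDual σ S (a i)).comp
    (ContinuousLinearMap.proj (φ := fun _ : ι => ℝ × EuclideanSpace ℝ (Fin k)) i)

theorem cameronMartin_pi_rowNoise {ι : Type*} [Fintype ι] {σ : ℝ} (hσ : 0 < σ) {k : ℕ}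
    {S : Matrix (Fin k) (Fin k) ℝ} (hS : S.PosDef) (a : ι → ℝ × EuclideanSpace ℝ (Fin k)) :
    CameronMartin (Measure.pi fun _ : ι => rowNoise σ S) (rowsDual σ S a) a :=
  CameronMartin.pi fun i => cameronMartin_rowNoise hσ hS (a i)

theorem rowsDual_apply_self {ι : Type*} [Fintype ι] (σ : ℝ) {k : ℕ}
    (S : Matrix (Fin k) (Fin k) ℝ) (a : ι → ℝ × EuclideanSpace ℝ (Fin k)) :
    rowsDual σ S a a =
      ∑ i, ((a i).1 ^ 2 / σ ^ 2 + dotProduct (a i).2.ofLp (S⁻¹.mulVec (a i).2.ofLp)) := by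
  simp [rowsDual, rowDual_apply_self]

end CameronMartinInstances

/-! ### Changing finitely many factors of an infinite product measure. -/

section InfiniteProduct

variable {ι Y : Type*}

open Classical in
/-- The family with the values of `p.1` in `F` and the values of `p.2` elsewhere. -/
noncomputable def glue (F : Finset ι) (p : (F → Y) × (ι → Y)) : ι → Y :=
  fun i => if h : i ∈ F then p.1 ⟨i, h⟩ else p.2 i

theorem glue_of_mem {F : Finset ι} (p : (F → Y) × (ι → Y)) {i : ι} (h : i ∈ F) :
    glue F p i = p.1 ⟨i, h⟩ := dif_pos h

theorem glue_of_notMem {F : Finset ι} (p : (F → Y) × (ι → Y)) {i : ι} (h : i ∉ F) :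
    glue F p i = p.2 i := dif_neg h

variable [MeasurableSpace Y] {ρ ρ' : ι → Measure Y}
  [∀ i, IsProbabilityMeasure (ρ i)] [∀ i, IsProbabilityMeasure (ρ' i)]

-- Resampling one coordinate from its new law yields the product with that factor replaced; it
-- suffices to check finite boxes.
open Classical in
theorem map_update_infinitePi (i : ι) (h : ∀ j, j ≠ i → ρ j = ρ' j) :
    ((ρ' i).prod (Measure.infinitePi ρ)).map (fun p => Function.update p.2 i p.1) =
      Measure.infinitePi ρ' := by
  refine Measure.eq_infinitePi ρ' fun s t ht => ?_
  have hm : Measurable (fun p : Y × (ι → Y) => Function.update p.2 i p.1) := by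
    rw [measurable_pi_iff]
    intro j
    by_cases hj : j = i
    · subst hj
      simpa using measurable_fst
    · simp only [Function.update_of_ne hj]
      fun_prop
  rw [Measure.map_apply hm (MeasurableSet.pi s.countable_toSet fun j _ => ht j)]
  by_cases hi : i ∈ s
  · have : (fun p : Y × (ι → Y) => Function.update p.2 i p.1) ⁻¹' (Set.pi s t) =
        t i ×ˢ Set.pi (s.erase i) t := by
      ext p
      simp only [Set.mem_preimage, Set.mem_pi, Set.mem_prod, Finset.mem_coe, Finset.mem_erase]
      constructor
      · intro hp
        refine ⟨by simpa using hp i hi, fun j hj => ?_⟩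
        simpa [Function.update_of_ne hj.1] using hp j hj.2
      · rintro ⟨h1, h2⟩ j hj
        by_cases hji : j = i
        · subst hji
          simpa using h1
        · simpa [Function.update_of_ne hji] using h2 j ⟨hji, hj⟩
    rw [this, Measure.prod_prod, Measure.infinitePi_pi _ (fun j _ => ht j),
      ← Finset.mul_prod_erase s _ hi]
    congr 1
    exact Finset.prod_congr rfl fun j hj => by rw [h j (Finset.ne_of_mem_erase hj)]
  · have : (fun p : Y × (ι → Y) => Function.update p.2 i p.1) ⁻¹' (Set.pi s t) =
        Set.univ ×ˢ Set.pi s t := by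
      ext p
      simp only [Set.mem_preimage, Set.mem_pi, Set.mem_prod, Finset.mem_coe, Set.mem_univ,
        true_and]
      refine forall₂_congr fun j hj => ?_
      rw [Function.update_of_ne (ne_of_mem_of_not_mem hj hi)]
    rw [this, Measure.prod_prod, Measure.infinitePi_pi _ (fun j _ => ht j), measure_univ, one_mul]
    exact Finset.prod_congr rfl fun j hj => by rw [h j (ne_of_mem_of_not_mem hj hi)]

-- The factors in `H` are exchanged one at a time. Conditionally on the other coordinates each
-- exchange costs one factor `c`.
open Classical in
theorem smul_infinitePi_le (c : ENNReal) (H : Finset ι) (h : ∀ i, i ∉ H → ρ i = ρ' i)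
    (hc : ∀ i ∈ H, c • ρ i ≤ ρ' i) :
    c ^ H.card • Measure.infinitePi ρ ≤ Measure.infinitePi ρ' := by
  induction H using Finset.induction_on generalizing ρ with
  | empty =>
    have : ρ = ρ' := funext fun i => h i (by simp)
    subst this
    simp
  | insert i H hi ih =>
    let ρ'' : ι → Measure Y := fun j => if j = i then ρ' j else ρ j
    have hρ'' : ∀ j, IsProbabilityMeasure (ρ'' j) := fun j => by
      by_cases hj : j = i <;> simp only [ρ'', hj, if_true, if_false] <;> infer_instance
    have h1 : c ^ H.card • Measure.infinitePi ρ'' ≤ Measure.infinitePi ρ' := by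
      refine ih (fun j hj => ?_) fun j hj => ?_
      · by_cases hji : j = i
        · simp [ρ'', hji]
        · simpa [ρ'', hji] using h j (by simp [hji, hj])
      · have hji : j ≠ i := ne_of_mem_of_not_mem hj hi
        simpa [ρ'', hji] using hc j (Finset.mem_insert_of_mem hj)
    have h2 : c • Measure.infinitePi ρ ≤ Measure.infinitePi ρ'' := by
      have hm : Measurable (fun p : Y × (ι → Y) => Function.update p.2 i p.1) := by
        rw [measurable_pi_iff]
        intro j
        by_cases hj : j = i
        · subst hj
          simpa using measurable_fst
        · simp only [Function.update_of_ne hj]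
          fun_prop
      have e1 := map_update_infinitePi (ρ := ρ) (ρ' := ρ) i fun _ _ => rfl
      have e2 := map_update_infinitePi (ρ := ρ) (ρ' := ρ'') i fun j hj => by simp [ρ'', hj]
      rw [← e2]
      nth_rewrite 1 [← e1]
      refine Measure.le_iff.2 fun s hs => ?_
      rw [Measure.smul_apply, Measure.map_apply hm hs, Measure.map_apply hm hs,
        Measure.prod_apply_symm (hm hs), Measure.prod_apply_symm (hm hs), smul_eq_mul,
        ← lintegral_const_mul _ (measurable_measure_prodMk_right (hm hs))]
      refine lintegral_mono fun y => ?_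
      simpa [ρ''] using hc i (Finset.mem_insert_self i H) _
    rw [Finset.card_insert_of_notMem hi, pow_succ, mul_smul]
    refine le_trans ?_ h1
    refine Measure.le_iff.2 fun s _ => ?_
    simp only [Measure.smul_apply _ (c • _), Measure.smul_apply _ (Measure.infinitePi ρ''),
      smul_eq_mul]
    gcongr

theorem measurable_glue (F : Finset ι) :
    Measurable (glue F : (F → Y) × (ι → Y) → ι → Y) := by
  rw [measurable_pi_iff]
  intro i
  by_cases h : i ∈ F
  · simp only [glue_of_mem _ h]
    fun_prop
  · simp only [glue_of_notMem _ h]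
    fun_prop

/-- Both infinite products become images of a finite block times the same remainder, so a comparison
on the block transfers by `HockeyStickLE.prod` and `HockeyStickLE.map`. -/
theorem map_glue_infinitePi (F : Finset ι) (h : ∀ i, i ∉ F → ρ i = ρ' i) :
    ((Measure.pi fun i : F => ρ' i).prod (Measure.infinitePi ρ)).map (glue F) =
      Measure.infinitePi ρ' := by
  classical
  refine Measure.eq_infinitePi ρ' fun s t ht => ?_
  rw [Measure.map_apply (measurable_glue F)
    (MeasurableSet.pi s.countable_toSet fun j _ => ht j)]
  have : glue F ⁻¹' (Set.pi s t) =
      (Set.univ.pi fun i : F => if (i : ι) ∈ s then t i else Set.univ) ×ˢ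
        Set.pi (s \ F : Finset ι) t := by
    ext p
    simp only [Set.mem_preimage, Set.mem_pi, Set.mem_prod, Finset.mem_coe, Finset.mem_sdiff,
      Set.mem_univ, forall_const]
    constructor
    · intro hp
      refine ⟨fun i => ?_, fun i hi => ?_⟩
      · by_cases hi : (i : ι) ∈ s
        · simpa [hi, glue_of_mem p i.2] using hp i hi
        · simp [hi]
      · simpa [glue_of_notMem p hi.2] using hp i hi.1
    · rintro ⟨h1, h2⟩ i hi
      by_cases hF : i ∈ F
      · simpa [glue_of_mem p hF, hi] using h1 ⟨i, hF⟩
      · simpa [glue_of_notMem p hF] using h2 i ⟨hi, hF⟩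
  rw [this, Measure.prod_prod, Measure.pi_pi, Measure.infinitePi_pi _ (fun j _ => ht j),
    ← Finset.prod_inter_mul_prod_sdiff s F]
  congr 1
  · rw [Finset.prod_coe_sort F fun i => ρ' i (if i ∈ s then t i else Set.univ),
      Finset.inter_comm, ← Finset.filter_mem_eq_inter, Finset.prod_filter]
    refine Finset.prod_congr rfl fun i _ => ?_
    split_ifs <;> simp
  · exact Finset.prod_congr rfl fun i hi => by rw [h i (Finset.mem_sdiff.1 hi).2]

theorem infinitePi_pi_inter_restrict {F H : Finset ι} (hd : Disjoint F H) {B : ι → Set Y}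
    (hB : ∀ i, MeasurableSet (B i)) {T : Set (F → Y)} (hT : MeasurableSet T) :
    Measure.infinitePi ρ (Set.pi H B ∩ F.restrict ⁻¹' T) =
      (∏ i ∈ H, ρ i (B i)) * Measure.pi (fun i : F => ρ i) T := by
  rw [← map_glue_infinitePi (ρ := ρ) (ρ' := ρ) F fun _ _ => rfl,
    Measure.map_apply (measurable_glue F)
      ((MeasurableSet.pi H.countable_toSet fun j _ => hB j).inter (Finset.measurable_restrict F hT)),
    mul_comm, ← Measure.infinitePi_pi ρ (fun i _ => hB i), ← Measure.prod_prod]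
  congr 1
  ext p
  have h1 : F.restrict (glue F p) = p.1 := funext fun i => by
    rw [Finset.restrict, glue_of_mem p i.2]
  simp only [Set.mem_preimage, Set.mem_inter_iff, Set.mem_pi, Set.mem_prod, h1, Finset.mem_coe]
  rw [and_comm]
  refine and_congr_right fun _ => forall₂_congr fun i hi => ?_
  rw [glue_of_notMem p (Finset.disjoint_right.1 hd hi)]

end InfiniteProduct

/-! ### Groups affected by one individual. -/

section Datasets

variable {U G O : Type*} {Cu : ℕ}

theorem inGroup_subset {X X' : Dataset U G O Cu} (h : AddsOneUser X X') (g : G) :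
    X.inGroup g ⊆ X'.inGroup g := by
  classical
  exact Finset.filter_subset_filter _ h.1

/-- All new records belong to one user, who has at most one record per group. -/
theorem AddsOneUser.count_eq {X X' : Dataset U G O Cu} (h : AddsOneUser X X') {g : G}
    (hg : X.inGroup g ≠ X'.inGroup g) : X'.count g = X.count g + 1 := by
  classical
  have hsub := inGroup_subset h g
  obtain ⟨u, hu⟩ := h.2
  have h1 : (X'.inGroup g \ X.inGroup g).card = 1 := by
    refine le_antisymm (Finset.card_le_one.2 fun r hr s hs => ?_) (Finset.card_pos.2 ?_)
    · simp only [Dataset.inGroup, Finset.mem_sdiff, Finset.mem_filter, not_and] at hr hs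
      refine X'.one_per_group r hr.1.1 s hs.1.1 ?_ (hr.1.2.trans hs.1.2.symm)
      rw [hu r hr.1.1 fun hX => hr.2 hX hr.1.2, hu s hs.1.1 fun hX => hs.2 hX hs.1.2]
    · rw [Finset.sdiff_nonempty]
      exact fun hss => hg (hsub.antisymm hss)
  unfold Dataset.count
  rw [← Finset.card_sdiff_add_card_eq_card hsub, h1, add_comm]

/-- The groups affected by adding records of one individual are at most `Cu` in number. -/
theorem AddsOneUser.exists_affected {X X' : Dataset U G O Cu} (h : AddsOneUser X X') :
    ∃ D : Finset G, D.card ≤ Cu ∧ (∀ g, g ∉ D → X.inGroup g = X'.inGroup g) ∧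
      ∀ g ∈ D, X'.count g = X.count g + 1 := by
  classical
  obtain ⟨u, hu⟩ := h.2
  set T : Set G := {g | ∃ r ∈ X'.records, r.user = u ∧ r.group = g}
  -- Finiteness makes the `ncard` bound a genuine one, since `ncard` of an infinite set is `0`.
  have hT : T.Finite := (X'.records.finite_toSet.image Record.group).subset <| by
    rintro g ⟨r, hr, -, rfl⟩
    exact ⟨r, hr, rfl⟩
  refine ⟨hT.toFinset.filter fun g => X.inGroup g ≠ X'.inGroup g, ?_, fun g hg => ?_,
    fun g hg => h.count_eq (Finset.mem_filter.1 hg).2⟩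
  · refine (Finset.card_filter_le _ _).trans ?_
    rw [← Set.ncard_eq_toFinset_card T hT]
    exact X'.bounded u
  · by_contra hne
    refine hg (Finset.mem_filter.2 ⟨?_, hne⟩)
    have : ¬ X'.inGroup g ⊆ X.inGroup g := fun hss => hne ((inGroup_subset h g).antisymm hss)
    obtain ⟨r, hr, hr'⟩ := Finset.not_subset.1 this
    simp only [Dataset.inGroup, Finset.mem_filter, not_and] at hr hr'
    exact hT.mem_toFinset.2 ⟨r, hr.1, hu r hr.1 fun hX => hr' hX hr.2, hr.2⟩

end Datasets

/-! ### The law of a single row. -/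

section RowLaw

variable {k : ℕ} {τ : ℕ} {τs σ : ℝ} {S : Matrix (Fin k) (Fin k) ℝ}

theorem gaussianReal_Iio (hσ : 0 < σ) (x : ℝ) :
    gaussianReal 0 (Real.toNNReal (σ ^ 2)) (Set.Iio x) = ENNReal.ofReal (Phi (x / σ)) := by
  have h : (gaussianReal 0 1).map (fun y => σ * y) = gaussianReal 0 (Real.toNNReal (σ ^ 2)) := by
    rw [gaussianReal_map_const_mul, mul_zero, mul_one]
    congr 1
    ext
    simp [max_eq_left (sq_nonneg σ)]
  have := nullSingletonClass_gaussianReal (μ := 0) (v := 1) one_ne_zero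
  rw [← h, Measure.map_apply (by fun_prop) measurableSet_Iio, Phi_eq_real, ofReal_measureReal,
    ← measure_congr Iio_ae_eq_Iic]
  congr 1
  ext y
  simp [lt_div_iff₀ hσ, mul_comm]

theorem map_row_of_lt {c : ℕ} (hc : c < τ) (a : EuclideanSpace ℝ (Fin k)) :
    (rowNoise σ S).map (row τ τs c a) = Measure.dirac (Sum.inl ()) := by
  have : row τ τs c a = fun _ => Sum.inl () := by
    funext w
    simp [row, not_le.2 hc]
  rw [this, Measure.map_const]
  simp

theorem measurableSet_null : MeasurableSet ({Sum.inl ()} : Set (Row k)) := by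
  rw [← Set.image_singleton]
  exact measurableSet_inl_image.2 (measurableSet_singleton _)

theorem map_row_null_of_eq (hσ : 0 < σ) (a : EuclideanSpace ℝ (Fin k)) :
    (rowNoise σ S).map (row τ τs τ a) {Sum.inl ()} = ENNReal.ofReal (Phi ((τs - τ) / σ)) := by
  rw [Measure.map_apply (measurable_row τ τs τ a) measurableSet_null,
    ← gaussianReal_Iio hσ]
  have : row τ τs τ a ⁻¹' {Sum.inl ()} = Set.Iio (τs - τ) ×ˢ Set.univ := by
    ext w
    simp [row, lt_sub_iff_add_lt']
  rw [this, rowNoise, Measure.prod_prod, measure_univ, mul_one]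

/-- At count `τ` the null row is an atom of mass `Phi ((τs - τ) / σ)`. This domination is all that
the upper bound needs about rows crossing the threshold. -/
theorem smul_dirac_le_map_row (hσ : 0 < σ) (a : EuclideanSpace ℝ (Fin k)) :
    ENNReal.ofReal (Phi ((τs - τ) / σ)) • Measure.dirac (Sum.inl ()) ≤
      (rowNoise σ S).map (row τ τs τ a) := by
  refine Measure.le_iff.2 fun s hs => ?_
  rw [← map_row_null_of_eq (S := S) hσ a, Measure.smul_apply, Measure.dirac_apply' _ hs]
  by_cases h : Sum.inl () ∈ s
  · simpa [h] using measure_mono (Set.singleton_subset_iff.2 h)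
  · simp [h]

/-- From the threshold on, a row depends only on data plus noise, so a change of the data is a shift
of the noise under a fixed post-processing. -/
theorem row_eq_row_add {c c' : ℕ} (hc : τ ≤ c) (hc' : τ ≤ c') (a a' : EuclideanSpace ℝ (Fin k))
    (w : ℝ × EuclideanSpace ℝ (Fin k)) :
    row τ τs c' a' w = row τ τs c a (w + ((c' : ℝ) - c, a' - a)) := by
  have h1 : (c : ℝ) + (w.1 + (c' - c)) = c' + w.1 := by ring
  have h2 : a + (w.2 + (a' - a)) = a' + w.2 := by abel
  simp [row, hc, hc', h1, h2]

theorem measurable_rows {ι : Type*} (τ : ℕ) (τs : ℝ) (c : ι → ℕ)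
    (a : ι → EuclideanSpace ℝ (Fin k)) :
    Measurable fun (u : ι → ℝ × EuclideanSpace ℝ (Fin k)) i => row τ τs (c i) (a i) (u i) :=
  measurable_pi_iff.2 fun i => (measurable_row τ τs (c i) (a i)).comp (measurable_pi_apply i)

theorem pi_map_row {ι : Type*} [Fintype ι] (c : ι → ℕ) (a : ι → EuclideanSpace ℝ (Fin k)) :
    Measure.pi (fun i => (rowNoise σ S).map (row τ τs (c i) (a i))) =
      (Measure.pi fun _ : ι => rowNoise σ S).map (fun u i => row τ τs (c i) (a i) (u i)) :=
  (Measure.pi_map_pi fun i => (measurable_row τ τs (c i) (a i)).aemeasurable).symm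

theorem pi_map_row_eq_shift {ι : Type*} [Fintype ι] {c c' : ι → ℕ} (hc : ∀ i, τ ≤ c i)
    (hc' : ∀ i, τ ≤ c' i) (a a' : ι → EuclideanSpace ℝ (Fin k)) :
    Measure.pi (fun i => (rowNoise σ S).map (row τ τs (c' i) (a' i))) =
      ((Measure.pi fun _ : ι => rowNoise σ S).map
        (fun u => u + fun i => ((c' i : ℝ) - c i, a' i - a i))).map
        (fun u i => row τ τs (c i) (a i) (u i)) := by
  rw [pi_map_row, Measure.map_map (measurable_rows τ τs c a) (by fun_prop)]
  congr 1
  funext u i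
  exact row_eq_row_add (hc i) (hc' i) _ _ _

end RowLaw

/-! ### Privacy for every aggregation function. -/

section UpperBound

variable {k : ℕ} {τ : ℕ} {τs σ : ℝ} {S : Matrix (Fin k) (Fin k) ℝ}

/-- Releasing finitely many rows with shifted counts and aggregates, all counts being above the
threshold, costs as much as the Gaussian mechanism. -/
theorem hockeyStickLE_infinitePi_rows {G : Type*} (hσ : 0 < σ) (hS : S.PosDef) (F : Finset G)
    {ρ ρ' : G → Measure (Row k)} [∀ g, IsProbabilityMeasure (ρ g)]
    [∀ g, IsProbabilityMeasure (ρ' g)] (hoff : ∀ g, g ∉ F → ρ g = ρ' g) {c c' : G → ℕ}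
    {a a' : G → EuclideanSpace ℝ (Fin k)} (hc : ∀ g ∈ F, τ ≤ c g) (hc' : ∀ g ∈ F, τ ≤ c' g)
    (hρ : ∀ g ∈ F, ρ g = (rowNoise σ S).map (row τ τs (c g) (a g)))
    (hρ' : ∀ g ∈ F, ρ' g = (rowNoise σ S).map (row τ τs (c' g) (a' g)))
    {d : ℝ} (hd : 0 < d)
    (hdd : ∑ g ∈ F, (((c' g : ℝ) - c g) ^ 2 / σ ^ 2 +
      dotProduct (a' g - a g).ofLp (S⁻¹.mulVec (a' g - a g).ofLp)) = d ^ 2) (ε : ℝ) :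
    HockeyStickLE (Measure.infinitePi ρ') (Measure.infinitePi ρ) ε (f d ε) ∧
      HockeyStickLE (Measure.infinitePi ρ) (Measure.infinitePi ρ') ε (f d ε) := by
  set w : F → ℝ × EuclideanSpace ℝ (Fin k) := fun g => ((c' g : ℝ) - c g, a' g - a g)
  have hCM := cameronMartin_pi_rowNoise hσ hS w
  have hself : rowsDual σ S w w = d ^ 2 := by
    rw [rowsDual_apply_self, ← hdd, ← Finset.sum_coe_sort F]
  set T : (F → ℝ × EuclideanSpace ℝ (Fin k)) → F → Row k :=
    fun u g => row τ τs (c g) (a g) (u g)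
  have e1 : Measure.pi (fun g : F => ρ g) = (Measure.pi fun _ : F => rowNoise σ S).map T := by
    simp only [fun g : F => hρ g g.2]
    exact pi_map_row _ _
  have e2 : Measure.pi (fun g : F => ρ' g) =
      ((Measure.pi fun _ : F => rowNoise σ S).map fun u => u + w).map T := by
    simp only [fun g : F => hρ' g g.2]
    exact pi_map_row_eq_shift (fun g : F => hc g g.2) (fun g : F => hc' g g.2) _ _
  -- Both laws are written as an `F`-block glued onto the same remainder drawn from `ρ`.
  rw [← map_glue_infinitePi (ρ := ρ) (ρ' := ρ') F hoff]
  nth_rewrite 2 [← map_glue_infinitePi (ρ := ρ) (ρ' := ρ) F fun _ _ => rfl]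
  nth_rewrite 3 [← map_glue_infinitePi (ρ := ρ) (ρ' := ρ) F fun _ _ => rfl]
  rw [e1, e2]
  have hm : Measurable T := measurable_rows τ τs (fun g : F => c g) (fun g : F => a g)
  exact ⟨(((hCM.hockeyStickLE hd hself ε).map hm).prod _).map (measurable_glue F),
    (((hCM.hockeyStickLE' hd hself ε).map hm).prod _).map (measurable_glue F)⟩

theorem mu_pos (hσ : 0 < σ) (μ₀ : ℝ) {p : ℕ} (hp : 0 < p) : 0 < mu σ μ₀ p := by
  have : (0 : ℝ) < p := by exact_mod_cast hp
  unfold mu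
  positivity

theorem mu_mono (hσ : 0 < σ) (μ₀ : ℝ) {p q : ℕ} (h : p ≤ q) : mu σ μ₀ p ≤ mu σ μ₀ q := by
  have : (p : ℝ) ≤ q := by exact_mod_cast h
  unfold mu
  gcongr

theorem quadForm_nonneg (hS : S.PosDef) (a : Fin k → ℝ) :
    0 ≤ dotProduct a (S⁻¹.mulVec a) := by
  simpa using hS.inv.posSemidef.dotProduct_mulVec_nonneg a

/-- `eps2` is the privacy parameter at which the factor `Phi ((τs - τ) / σ) ^ e` brings `exp` back
to `exp ε`. -/
theorem exp_eps2 (ε : ℝ) (e : ℕ) :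
    Phi ((τs - τ) / σ) ^ e * Real.exp (eps2 τ τs σ ε e) = Real.exp ε := by
  rw [eps2, Real.exp_sub, mul_comm (e : ℝ), ← Real.rpow_def_of_pos (Phi_pos _),
    Real.rpow_natCast]
  have := pow_pos (Phi_pos ((τs - τ) / σ)) e
  field_simp

theorem exp_eps3 (ε : ℝ) (e : ℕ) :
    Real.exp (eps3 τ τs σ ε e) = Real.exp ε * Phi ((τs - τ) / σ) ^ e := by
  rw [eps3, Real.exp_add, mul_comm (e : ℝ), ← Real.rpow_def_of_pos (Phi_pos _),
    Real.rpow_natCast]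

theorem deltaInfinite_nonneg (τ : ℕ) (τs σ : ℝ) (Cu : ℕ) : 0 ≤ deltaInfinite τ τs σ Cu :=
  sub_nonneg.2 (pow_le_one₀ (Phi_pos _).le (Phi_lt_one _).le)

-- Both directions pass through the law `ρ₁`, which has the Gaussian shift on `F` but not yet the
-- threshold crossings on `H`.
open Classical in
theorem mechanism_real_le {U G O : Type*} {Cu : ℕ} (hσ : 0 < σ) (hS : S.PosDef) {μ₀ ε δ : ℝ}
    (hε : 0 ≤ ε) (hδ : ∀ t ∈ deltaTerms τ τs σ μ₀ Cu ε, t ≤ δ) {A : Aggregation U G O k}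
    (hA : HasSensitivity Cu S A μ₀) {X X' : Dataset U G O Cu} (h : AddsOneUser X X')
    {E : Set (G → Row k)} (hE : MeasurableSet E) :
    (mechanism τ τs σ S A X).real E ≤ Real.exp ε * (mechanism τ τs σ S A X').real E + δ ∧
      (mechanism τ τs σ S A X').real E ≤ Real.exp ε * (mechanism τ τs σ S A X).real E + δ := by
  obtain ⟨D, hDcard, hDoff, hD⟩ := h.exists_affected
  let ρ : G → Measure (Row k) := fun g =>
    (rowNoise σ S).map (row τ τs (X.count g) (A g (X.inGroup g)))
  let ρ' : G → Measure (Row k) := fun g =>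
    (rowNoise σ S).map (row τ τs (X'.count g) (A g (X'.inGroup g)))
  let F := D.filter fun g => τ ≤ X.count g
  let H := D.filter fun g => X.count g + 1 = τ
  let ρ₁ : G → Measure (Row k) := fun g => if g ∈ F then ρ' g else ρ g
  have hρp : ∀ g, IsProbabilityMeasure (ρ g) := fun g => isProbabilityMeasure_rowLaw ..
  have hρ'p : ∀ g, IsProbabilityMeasure (ρ' g) := fun g => isProbabilityMeasure_rowLaw ..
  have hρ₁p : ∀ g, IsProbabilityMeasure (ρ₁ g) := fun g => by
    by_cases hg : g ∈ F <;> simp only [ρ₁, hg, if_true, if_false] <;> infer_instance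
  have hM : mechanism τ τs σ S A X = Measure.infinitePi ρ := rfl
  have hM' : mechanism τ τs σ S A X' = Measure.infinitePi ρ' := rfl
  have hFH : Disjoint F H := by
    refine Finset.disjoint_filter.2 fun g _ h1 h2 => ?_
    omega
  have hcard : F.card + H.card ≤ Cu := by
    rw [← Finset.card_union_of_disjoint hFH]
    refine (Finset.card_le_card ?_).trans hDcard
    exact Finset.union_subset (Finset.filter_subset _ _) (Finset.filter_subset _ _)
  set r := Phi ((τs - τ) / σ) with hr
  have hr0 : 0 < r := Phi_pos _
  have hr1 : r < 1 := Phi_lt_one _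
  set e := H.card with he
  have hre0 : 0 < r ^ e := pow_pos hr0 e
  have hre1 : r ^ e ≤ 1 := pow_le_one₀ hr0.le hr1.le
  have hdom : ENNReal.ofReal r ^ e • Measure.infinitePi ρ₁ ≤ Measure.infinitePi ρ' := by
    refine smul_infinitePi_le _ H (fun g hg => ?_) fun g hg => ?_
    · by_cases hgF : g ∈ F
      · simp [ρ₁, hgF]
      · simp only [ρ₁, hgF, if_false, ρ, ρ']
        by_cases hgD : g ∈ D
        · have h1 : ¬ τ ≤ X.count g := fun hh => hgF (Finset.mem_filter.2 ⟨hgD, hh⟩)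
          have h2 : ¬ X.count g + 1 = τ := fun hh => hg (Finset.mem_filter.2 ⟨hgD, hh⟩)
          rw [map_row_of_lt (by omega), map_row_of_lt (by rw [hD g hgD]; omega)]
        · rw [Dataset.count, Dataset.count, hDoff g hgD]
    · have hg' := Finset.mem_filter.1 hg
      have hgF : g ∉ F := Finset.disjoint_right.1 hFH hg
      have h1 : X'.count g = τ := by rw [hD g hg'.1, hg'.2]
      simp only [ρ₁, hgF, if_false, ρ, ρ', h1]
      rw [map_row_of_lt (by omega)]
      exact smul_dirac_le_map_row hσ _
  have hdom_real (B : Set (G → Row k)) :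
      r ^ e * (Measure.infinitePi ρ₁).real B ≤ (Measure.infinitePi ρ').real B := by
    have := ENNReal.toReal_mono (measure_ne_top _ _) (hdom B)
    simpa [measureReal_def, ENNReal.toReal_ofReal hr0.le] using this
  -- Domination applied to the complement of `E` bounds the law of `X'` from above.
  have hdom_compl : (Measure.infinitePi ρ').real E ≤
      1 - r ^ e + r ^ e * (Measure.infinitePi ρ₁).real E := by
    have := hdom_real Eᶜ
    rw [probReal_compl_eq_one_sub hE, probReal_compl_eq_one_sub hE] at this
    linarith
  have hexp : 1 ≤ Real.exp ε := Real.one_le_exp hε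
  rw [hM, hM']
  -- With `F` empty there is no Gaussian shift, and the term `1 - r ^ e ≤ deltaInfinite` suffices
  -- because `exp ε ≥ 1`.
  rcases F.eq_empty_or_nonempty with hF | hF
  · have hρρ : ρ₁ = ρ := by
      funext g
      simp [ρ₁, hF]
    have h1 := hdom_real E
    simp only [hρρ] at h1 hdom_compl
    have hinf : 1 - r ^ e ≤ δ := by
      refine le_trans ?_ (hδ _ (Or.inl (Or.inl rfl)))
      have := pow_le_pow_of_le_one hr0.le hr1.le (show e ≤ Cu by omega)
      simp only [deltaInfinite]
      linarith
    have hx : 0 ≤ (Measure.infinitePi ρ).real E := measureReal_nonneg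
    have hx1 : (Measure.infinitePi ρ).real E ≤ 1 := measureReal_le_one
    have hy : 0 ≤ (Measure.infinitePi ρ').real E := measureReal_nonneg
    constructor
    · nlinarith
    · nlinarith
  · let q : G → ℝ := fun g => dotProduct (A g (X'.inGroup g) - A g (X.inGroup g)).ofLp
      (S⁻¹.mulVec (A g (X'.inGroup g) - A g (X.inGroup g)).ofLp)
    have hq (g : G) : q g ≤ μ₀ ^ 2 := hA.2.2 ⟨g, X', X, Or.inr h, rfl⟩
    have hq0 (g : G) : 0 ≤ q g := quadForm_nonneg hS _
    set s : ℝ := ∑ g ∈ F, (((X'.count g : ℝ) - X.count g) ^ 2 / σ ^ 2 + q g) with hs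
    have hterm : ∀ g ∈ F, ((X'.count g : ℝ) - X.count g) ^ 2 / σ ^ 2 + q g = 1 / σ ^ 2 + q g := by
      intro g hg
      rw [hD g (Finset.mem_filter.1 hg).1]
      push_cast
      ring
    have hs0 : 0 < s := by
      refine Finset.sum_pos (fun g hg => ?_) hF
      rw [hterm g hg]
      have := hq0 g
      positivity
    have hd : 0 < Real.sqrt s := Real.sqrt_pos.2 hs0
    -- Fewer than `Cu` rows may matter; replacing `F.card` by `Cu - e` only enlarges `mu` and
    -- produces an admissible pair.
    have hdmu : Real.sqrt s ≤ mu σ μ₀ (Cu - e) := by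
      refine le_trans ?_ (mu_mono hσ μ₀ (show F.card ≤ Cu - e by omega))
      refine Real.sqrt_le_sqrt ?_
      rw [hs, Finset.sum_congr rfl hterm]
      refine (Finset.sum_le_card_nsmul _ _ (1 / σ ^ 2 + μ₀ ^ 2) fun g _ => ?_).trans_eq ?_
      · gcongr
        exact hq g
      · rw [nsmul_eq_mul]
        ring
    have hFpos := Finset.card_pos.2 hF
    have key (ε' : ℝ) := hockeyStickLE_infinitePi_rows (τ := τ) (τs := τs) hσ hS F (ρ := ρ)
      (ρ' := ρ₁)
      (fun g hg => by simp [ρ₁, hg]) (c := X.count) (c' := X'.count)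
      (a := fun g => A g (X.inGroup g)) (a' := fun g => A g (X'.inGroup g))
      (fun g hg => (Finset.mem_filter.1 hg).2)
      (fun g hg => by
        rw [hD g (Finset.mem_filter.1 hg).1]
        exact (Finset.mem_filter.1 hg).2.trans (Nat.le_succ _))
      (fun g _ => rfl) (fun g hg => by simp [ρ₁, hg, ρ']) hd (Real.sq_sqrt hs0.le).symm ε'
    constructor
    · have h1 := (key (eps3 τ τs σ ε e)).2.real (f_nonneg hd _) hE
      rw [exp_eps3] at h1
      have h2 := hδ _ (Or.inr ⟨Cu - e, e, by omega, by omega, rfl⟩)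
      have h3 := f_mono_left hd hdmu (eps3 τ τs σ ε e)
      have h4 := mul_le_mul_of_nonneg_left (hdom_real E) (Real.exp_pos ε).le
      rw [← mul_assoc] at h4
      linarith
    · have h1 := (key (eps2 τ τs σ ε e)).1.real (f_nonneg hd _) hE
      have h2 := hδ _ (Or.inl (Or.inr ⟨Cu - e, e, by omega, by omega, rfl⟩))
      have h3 := f_mono_left hd hdmu (eps2 τ τs σ ε e)
      have h4 := mul_le_mul_of_nonneg_left (h1.trans (add_le_add_right h3 _)) hre0.le
      rw [mul_add, ← mul_assoc, exp_eps2] at h4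
      linarith

theorem isDP_mechanism {U G O : Type*} {Cu : ℕ} (hσ : 0 < σ) (hS : S.PosDef) {μ₀ ε δ : ℝ}
    (hε : 0 ≤ ε) (hδ : ∀ t ∈ deltaTerms τ τs σ μ₀ Cu ε, t ≤ δ) (hδ1 : δ ≤ 1)
    {A : Aggregation U G O k} (hA : HasSensitivity Cu S A μ₀) :
    IsDP ε δ (fun X : Dataset U G O Cu => mechanism τ τs σ S A X) := by
  refine ⟨⟨(deltaInfinite_nonneg _ _ _ _).trans (hδ _ (Or.inl (Or.inl rfl))), hδ1⟩, ?_⟩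
  rintro X X' (h | h) E hE
  · exact (mechanism_real_le hσ hS hε hδ hA h hE).1
  · exact (mechanism_real_le hσ hS hε hδ hA h hE).2

end UpperBound

/-! ### Worst-case datasets and aggregation functions. -/

section TestDatasets

variable {U G O : Type*} {Cu : ℕ}

/-- The record of user number `p.2` in group `p.1`. -/
def numberedRecord (i : ℕ ↪ U) (o : O) : (Σ _ : G, ℕ) ↪ Record U G O where
  toFun p := ⟨i p.2, p.1, o⟩
  inj' := by
    rintro ⟨g, m⟩ ⟨g', m'⟩ h
    obtain ⟨h1, rfl, -⟩ := Record.mk.inj h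
    exact congrArg (Sigma.mk g) (i.injective h1)

/-- The dataset in which, for each group `g` of `D`, the users numbered by `N g` have one record
each. -/
def numberedDataset (i : ℕ ↪ U) (o : O) (D : Finset G) (hD : D.card ≤ Cu) (N : G → Finset ℕ) :
    Dataset U G O Cu where
  records := (D.sigma N).map (numberedRecord i o)
  one_per_group := by
    intro r hr s hs hu hg
    obtain ⟨p, -, rfl⟩ := Finset.mem_map.1 hr
    obtain ⟨p', -, rfl⟩ := Finset.mem_map.1 hs
    exact Record.ext hu hg rfl
  bounded := by
    intro u
    rw [← Set.ncard_coe_finset] at hD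
    refine (Set.ncard_le_ncard ?_ D.finite_toSet).trans hD
    rintro g ⟨r, hr, -, rfl⟩
    obtain ⟨p, hp, rfl⟩ := Finset.mem_map.1 hr
    exact (Finset.mem_sigma.1 hp).1

theorem count_numberedDataset (i : ℕ ↪ U) (o : O) (D : Finset G) (hD : D.card ≤ Cu)
    (N : G → Finset ℕ) {g : G} (hg : g ∈ D) :
    (numberedDataset i o D hD N).count g = (N g).card := by
  classical
  rw [Dataset.count, ← Finset.card_map (⟨fun m => (⟨i m, g, o⟩ : Record U G O), fun m m' h => by
    simpa using h⟩ : ℕ ↪ Record U G O)]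
  congr 1
  ext r
  simp only [Dataset.inGroup, numberedDataset, Finset.mem_filter, Finset.mem_map,
    Finset.mem_sigma]
  constructor
  · rintro ⟨⟨⟨g', m⟩, ⟨-, h⟩, rfl⟩, rfl⟩
    exact ⟨m, h, rfl⟩
  · rintro ⟨m, h, rfl⟩
    exact ⟨⟨⟨g, m⟩, ⟨hg, h⟩, rfl⟩, rfl⟩

theorem addsOneUser_numberedDataset (i : ℕ ↪ U) (o : O) (D : Finset G) (hD : D.card ≤ Cu)
    (N : G → Finset ℕ) (n : ℕ) :
    AddsOneUser (numberedDataset i o D hD N)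
      (numberedDataset i o D hD fun g => insert n (N g)) := by
  constructor
  · exact Finset.map_subset_map.2 (Finset.sigma_mono subset_rfl fun g => Finset.subset_insert _ _)
  · refine ⟨i n, fun r hr hr' => ?_⟩
    obtain ⟨p, hp, rfl⟩ := Finset.mem_map.1 hr
    obtain ⟨h1, h2⟩ := Finset.mem_sigma.1 hp
    rcases Finset.mem_insert.1 h2 with h | h
    · exact congrArg i h
    · exact absurd (Finset.mem_map_of_mem _ (Finset.mem_sigma.2 ⟨h1, h⟩)) hr'

/-- The aggregation function that sums the vector `v` over the records of a group. -/
noncomputable def sumAggregation (U G O : Type*) {k : ℕ} (v : EuclideanSpace ℝ (Fin k)) :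
    Aggregation U G O k :=
  fun _ s => (s.card : ℝ) • v

theorem Neighbors.abs_count_sub_le {X X' : Dataset U G O Cu} (h : Neighbors X X') (g : G) :
    |(X.count g : ℝ) - X'.count g| ≤ 1 := by
  wlog h1 : AddsOneUser X X' generalizing X X'
  · rw [abs_sub_comm]
    exact this (Or.symm h) (h.resolve_left h1)
  by_cases hg : X.inGroup g = X'.inGroup g
  · simp [Dataset.count, hg]
  · simp [h1.count_eq hg]

/-- Counts of neighbours differ by at most one, and adding a single record to the empty dataset
attains this. -/
theorem hasSensitivity_sumAggregation [Infinite U] [Nonempty O] [Nonempty G] (hCu : 1 ≤ Cu)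
    {k : ℕ} {S : Matrix (Fin k) (Fin k) ℝ} {μ₀ : ℝ} (hμ₀ : 0 ≤ μ₀)
    {v : EuclideanSpace ℝ (Fin k)} (hv : dotProduct v.ofLp (S⁻¹.mulVec v.ofLp) = μ₀ ^ 2) :
    HasSensitivity Cu S (sumAggregation U G O v) μ₀ := by
  have hq (g : G) (X X' : Dataset U G O Cu) :
      dotProduct (sumAggregation U G O v g (X.inGroup g) -
          sumAggregation U G O v g (X'.inGroup g)).ofLp
        (S⁻¹.mulVec (sumAggregation U G O v g (X.inGroup g) -
          sumAggregation U G O v g (X'.inGroup g)).ofLp) =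
        ((X.count g : ℝ) - X'.count g) ^ 2 * μ₀ ^ 2 := by
    rw [sumAggregation, sumAggregation, ← sub_smul, WithLp.ofLp_smul, Matrix.mulVec_smul,
      smul_dotProduct, dotProduct_smul, hv, smul_eq_mul, smul_eq_mul, ← mul_assoc, ← sq]
    rfl
  refine ⟨hμ₀, ?_, ?_⟩
  · obtain ⟨g⟩ := ‹Nonempty G›
    obtain ⟨o⟩ := ‹Nonempty O›
    have hD : ({g} : Finset G).card ≤ Cu := by simpa using hCu
    refine ⟨g, _, _, Or.inl (addsOneUser_numberedDataset (Infinite.natEmbedding U) o {g} hD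
      (fun _ => ∅) 0), ?_⟩
    rw [hq, count_numberedDataset _ _ _ _ _ (Finset.mem_singleton_self g),
      count_numberedDataset _ _ _ _ _ (Finset.mem_singleton_self g)]
    simp
  · rintro _ ⟨g, X, X', h, rfl⟩
    rw [hq]
    refine mul_le_of_le_one_left (sq_nonneg _) ?_
    exact (sq_le_one_iff_abs_le_one _).2 (h.abs_count_sub_le g)

/-- A basis vector is rescaled; for `k = 0` only the zero vector exists, which is why `μ₀` must then
vanish. -/
theorem exists_quadForm_eq {k : ℕ} {S : Matrix (Fin k) (Fin k) ℝ} (hS : S.PosDef) {μ₀ : ℝ}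
    (hk : k = 0 → μ₀ = 0) :
    ∃ v : EuclideanSpace ℝ (Fin k), dotProduct v.ofLp (S⁻¹.mulVec v.ofLp) = μ₀ ^ 2 := by
  rcases Nat.eq_zero_or_pos k with h | h
  · exact ⟨0, by simp [hk h]⟩
  · let x : Fin k → ℝ := Pi.single ⟨0, h⟩ 1
    have hx : 0 < dotProduct x (S⁻¹.mulVec x) := by
      simpa using hS.inv.dotProduct_mulVec_pos (x := x) (by simp [x])
    refine ⟨WithLp.toLp 2 ((μ₀ / Real.sqrt (dotProduct x (S⁻¹.mulVec x))) • x), ?_⟩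
    simp only [Matrix.mulVec_smul, smul_dotProduct, dotProduct_smul, smul_eq_mul]
    rw [← mul_assoc, ← sq, div_pow, Real.sq_sqrt hx.le]
    field_simp

theorem exists_finset_card_eq (h : (Cu : ℕ∞) ≤ ENat.card G) : ∃ D : Finset G, D.card = Cu := by
  rcases finite_or_infinite G with hG | hG
  · have := Fintype.ofFinite G
    rw [ENat.card_eq_coe_fintype_card, Nat.cast_le] at h
    obtain ⟨D, -, hD⟩ := Finset.exists_subset_card_eq (s := Finset.univ) h
    exact ⟨D, hD⟩
  · obtain ⟨D, hD⟩ := Infinite.exists_subset_card_eq G Cu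
    exact ⟨D, hD⟩

end TestDatasets

/-! ### Necessity of every term. -/

section LowerBound

variable {U G O : Type*} {Cu : ℕ} {k : ℕ} {τ : ℕ} {τs σ : ℝ} {S : Matrix (Fin k) (Fin k) ℝ}

theorem mechanism_real_null_inter (A : Aggregation U G O k) (X : Dataset U G O Cu) {F H : Finset G}
    (hd : Disjoint F H) {T : Set (F → Row k)} (hT : MeasurableSet T) {r : ℝ}
    (hr : ∀ g ∈ H, ((rowNoise σ S).map (row τ τs (X.count g) (A g (X.inGroup g)))).real
      {Sum.inl ()} = r) :
    (mechanism τ τs σ S A X).real (Set.pi H (fun _ => {Sum.inl ()}) ∩ F.restrict ⁻¹' T) =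
      r ^ H.card * (Measure.pi fun g : F =>
        (rowNoise σ S).map (row τ τs (X.count g) (A g (X.inGroup g)))).real T := by
  rw [mechanism, measureReal_def, infinitePi_pi_inter_restrict hd (fun _ => measurableSet_null) hT,
    ENNReal.toReal_mul, ENNReal.toReal_prod]
  congr 1
  rw [← Finset.prod_const]
  exact Finset.prod_congr rfl hr

/-- What `(ε, δ)`-privacy says about `F`-many rows with `n` and `n + 1` records, when as many
further rows as `H` has elements cross the threshold. -/
theorem IsDP.threshold_rows [Infinite U] [Nonempty O] (hτ : 1 ≤ τ) (hσ : 0 < σ) {ε δ : ℝ}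
    {v : EuclideanSpace ℝ (Fin k)}
    (h : IsDP ε δ (fun X : Dataset U G O Cu => mechanism τ τs σ S (sumAggregation U G O v) X))
    {F H : Finset G} (hd : Disjoint F H) (hcard : F.card + H.card = Cu) {n : ℕ} (hn : τ ≤ n)
    {T : Set (F → Row k)} (hT : MeasurableSet T) :
    (Measure.pi fun _ : F => (rowNoise σ S).map (row τ τs n ((n : ℝ) • v))).real T ≤
        Real.exp ε * (Phi ((τs - τ) / σ) ^ H.card * (Measure.pi fun _ : F =>
          (rowNoise σ S).map (row τ τs (n + 1) (((n + 1 : ℕ) : ℝ) • v))).real T) + δ ∧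
      1 - Phi ((τs - τ) / σ) ^ H.card + Phi ((τs - τ) / σ) ^ H.card * (Measure.pi fun _ : F =>
          (rowNoise σ S).map (row τ τs (n + 1) (((n + 1 : ℕ) : ℝ) • v))).real T ≤
        Real.exp ε * (Measure.pi fun _ : F =>
          (rowNoise σ S).map (row τ τs n ((n : ℝ) • v))).real T + δ := by
  classical
  obtain ⟨o⟩ := ‹Nonempty O›
  let D := F ∪ H
  have hD : D.card ≤ Cu := by rw [Finset.card_union_of_disjoint hd, hcard]
  -- The added user has number `n ≥ τ`, hence lies outside both ranges; `τ ≥ 1` makes the count in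
  -- `H` rise from `τ - 1` to exactly `τ`.
  let N : G → Finset ℕ := fun g => if g ∈ F then Finset.range n else Finset.range (τ - 1)
  let X : Dataset U G O Cu := numberedDataset (Infinite.natEmbedding U) o D hD N
  let X' : Dataset U G O Cu :=
    numberedDataset (Infinite.natEmbedding U) o D hD fun g => insert n (N g)
  have hadd : AddsOneUser X X' := addsOneUser_numberedDataset _ _ _ _ _ _
  have hF {g : G} (hg : g ∈ F) : X.count g = n ∧ X'.count g = n + 1 := by
    have hgD : g ∈ D := Finset.mem_union_left _ hg
    rw [count_numberedDataset _ _ _ _ _ hgD, count_numberedDataset _ _ _ _ _ hgD]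
    simp [N, hg]
  have hH {g : G} (hg : g ∈ H) : X.count g = τ - 1 ∧ X'.count g = τ := by
    have hgD : g ∈ D := Finset.mem_union_right _ hg
    have hgF : g ∉ F := Finset.disjoint_right.1 hd hg
    rw [count_numberedDataset _ _ _ _ _ hgD, count_numberedDataset _ _ _ _ _ hgD]
    rw [Finset.card_insert_of_notMem (by simp [N, hgF]; omega)]
    simp only [N, hgF, if_false, Finset.card_range, true_and]
    omega
  have hXH : ∀ g ∈ H, ((rowNoise σ S).map (row τ τs (X.count g)
      (sumAggregation U G O v g (X.inGroup g)))).real {Sum.inl ()} = 1 := by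
    intro g hg
    rw [map_row_of_lt (by rw [(hH hg).1]; omega), measureReal_def,
      Measure.dirac_apply' _ measurableSet_null]
    simp
  have hXH' : ∀ g ∈ H, ((rowNoise σ S).map (row τ τs (X'.count g)
      (sumAggregation U G O v g (X'.inGroup g)))).real {Sum.inl ()} = Phi ((τs - τ) / σ) := by
    intro g hg
    rw [(hH hg).2, measureReal_def, map_row_null_of_eq hσ, ENNReal.toReal_ofReal (Phi_pos _).le]
  have hXF : (fun g : F => (rowNoise σ S).map (row τ τs (X.count g)
      (sumAggregation U G O v g (X.inGroup g)))) =
      fun _ : F => (rowNoise σ S).map (row τ τs n ((n : ℝ) • v)) := by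
    funext g
    have : (X.inGroup g).card = n := (hF g.2).1
    rw [sumAggregation, this, (hF g.2).1]
  have hXF' : (fun g : F => (rowNoise σ S).map (row τ τs (X'.count g)
      (sumAggregation U G O v g (X'.inGroup g)))) =
      fun _ : F => (rowNoise σ S).map (row τ τs (n + 1) (((n + 1 : ℕ) : ℝ) • v)) := by
    funext g
    have : (X'.inGroup g).card = n + 1 := (hF g.2).2
    rw [sumAggregation, this, (hF g.2).2]
  have hmeas {T : Set (F → Row k)} (hT : MeasurableSet T) : MeasurableSet
      (Set.pi H (fun _ : G => ({Sum.inl ()} : Set (Row k))) ∩ F.restrict ⁻¹' T) :=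
    (MeasurableSet.pi H.countable_toSet fun _ _ => measurableSet_null).inter
      (Finset.measurable_restrict F hT)
  constructor
  · have := h.2 X X' (Or.inl hadd) _ (hmeas hT)
    rw [mechanism_real_null_inter _ _ hd hT hXH, mechanism_real_null_inter _ _ hd hT hXH', hXF,
      hXF', one_pow, one_mul] at this
    exact this
  · have := h.2 X' X (Or.inr hadd) _ (hmeas hT.compl).compl
    have hp (Y : Dataset U G O Cu) :
        IsProbabilityMeasure (mechanism τ τs σ S (sumAggregation U G O v) Y) := by
      unfold mechanism
      infer_instance
    rw [probReal_compl_eq_one_sub (hmeas hT.compl), probReal_compl_eq_one_sub (hmeas hT.compl),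
      mechanism_real_null_inter _ _ hd hT.compl hXH,
      mechanism_real_null_inter _ _ hd hT.compl hXH', hXF,
      hXF', one_pow, one_mul, probReal_compl_eq_one_sub hT, probReal_compl_eq_one_sub hT] at this
    linarith

/-- The noise of a released row with count `n` and aggregates `a`. -/
def rowResidual (n : ℝ) (a : EuclideanSpace ℝ (Fin k)) :
    Row k → ℝ × EuclideanSpace ℝ (Fin k) :=
  Sum.elim (fun _ => 0) fun p => (p.1 - n, p.2 - a)

theorem measurable_rowResidual (n : ℝ) (a : EuclideanSpace ℝ (Fin k)) :
    Measurable (rowResidual n a) :=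
  measurable_const.sumElim (by fun_prop)

/-- The noise for which all rows with `n` records are released. -/
def releaseSet (ι : Type*) (k : ℕ) (τs : ℝ) (n : ℕ) : Set (ι → ℝ × EuclideanSpace ℝ (Fin k)) :=
  {u | ∀ i, τs ≤ n + (u i).1}

theorem measurableSet_releaseSet (ι : Type*) [Finite ι] (k : ℕ) (τs : ℝ) (n : ℕ) :
    MeasurableSet (releaseSet ι k τs n) := by
  have : releaseSet ι k τs n = ⋂ i, {u | τs ≤ n + (u i).1} := by
    ext
    simp [releaseSet]
  rw [this]
  exact MeasurableSet.iInter fun i => measurableSet_le measurable_const (by fun_prop)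

/-- A released row reveals its noise, so any noise event, cut down to full release, is an event
about the output. -/
theorem exists_rows_preimage_eq {ι : Type*} [Finite ι] {n : ℕ} (hn : τ ≤ n)
    (a : EuclideanSpace ℝ (Fin k)) {T : Set (ι → ℝ × EuclideanSpace ℝ (Fin k))}
    (hT : MeasurableSet T) :
    ∃ T' : Set (ι → Row k), MeasurableSet T' ∧
      (fun u i => row τ τs n a (u i)) ⁻¹' T' = T ∩ releaseSet ι k τs n := by
  have hm : Measurable fun (x : ι → Row k) i => rowResidual n a (x i) :=
    measurable_pi_iff.2 fun i => (measurable_rowResidual n a).comp (measurable_pi_apply i)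
  refine ⟨(fun x i => rowResidual n a (x i)) ⁻¹' T ∩ ⋂ i, (fun x => x i) ⁻¹' {Sum.inl ()}ᶜ,
    (hm hT).inter (MeasurableSet.iInter fun i =>
      measurableSet_null.compl.preimage (measurable_pi_apply i)), ?_⟩
  ext u
  have hnull : (∀ i, row τ τs n a (u i) ≠ Sum.inl ()) ↔ u ∈ releaseSet ι k τs n := by
    refine forall_congr' fun i => ?_
    simp [row, hn]
  simp only [Set.mem_preimage, Set.mem_inter_iff, Set.mem_iInter, Set.mem_compl_iff,
    Set.mem_singleton_iff]
  rw [hnull]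
  refine and_congr_left fun hu => ?_
  have : (fun i => rowResidual n a (row τ τs n a (u i))) = u := by
    funext i
    simp [row, hn, hu i, rowResidual]
  rw [this]

/-- Continuity from below: for each noise value, all of the finitely many rows are released once `n`
is large. -/
theorem tendsto_real_inter_releaseSet {ι : Type*} [Finite ι] {Ω : Type*} [MeasurableSpace Ω]
    (ν : Measure Ω) [IsFiniteMeasure ν] (g : Ω → ι → ℝ × EuclideanSpace ℝ (Fin k)) (T : Set Ω) :
    Filter.Tendsto (fun n : ℕ => ν.real (T ∩ g ⁻¹' releaseSet ι k τs n)) Filter.atTop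
      (nhds (ν.real T)) := by
  have hmono : Monotone fun n : ℕ => T ∩ g ⁻¹' releaseSet ι k τs n := by
    intro m n hmn x hx
    refine ⟨hx.1, fun i => (hx.2 i).trans ?_⟩
    have : (m : ℝ) ≤ n := by exact_mod_cast hmn
    gcongr
  have hU : ⋃ n : ℕ, T ∩ g ⁻¹' releaseSet ι k τs n = T := by
    rw [← Set.inter_iUnion]
    refine Set.inter_eq_left.2 fun x _ => Set.mem_iUnion.2 ?_
    have := Fintype.ofFinite ι
    obtain ⟨n, hn⟩ := exists_nat_ge (∑ i, |τs - (g x i).1|)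
    refine ⟨n, fun i => ?_⟩
    have h1 := Finset.single_le_sum (f := fun i => |τs - (g x i).1|) (fun i _ => abs_nonneg _)
      (Finset.mem_univ i)
    have h2 := le_abs_self (τs - (g x i).1)
    linarith
  have := tendsto_measure_iUnion_atTop (μ := ν) hmono
  rw [hU] at this
  exact (ENNReal.tendsto_toReal (measure_ne_top ν T)).comp this

/-- In the limit of large counts the released rows carry the plain Gaussian mechanism. -/
theorem IsDP.gaussian_rows [Infinite U] [Nonempty O] (hτ : 1 ≤ τ) (hσ : 0 < σ) {ε δ : ℝ}
    {v : EuclideanSpace ℝ (Fin k)}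
    (h : IsDP ε δ (fun X : Dataset U G O Cu => mechanism τ τs σ S (sumAggregation U G O v) X))
    {F H : Finset G} (hd : Disjoint F H) (hcard : F.card + H.card = Cu)
    {T : Set (F → ℝ × EuclideanSpace ℝ (Fin k))} (hT : MeasurableSet T) :
    (Measure.pi fun _ : F => rowNoise σ S).real T ≤
        Real.exp ε * (Phi ((τs - τ) / σ) ^ H.card * (Measure.pi fun _ : F =>
          rowNoise σ S).real ((fun u => u + fun _ => (1, v)) ⁻¹' T)) + δ ∧
      1 - Phi ((τs - τ) / σ) ^ H.card + Phi ((τs - τ) / σ) ^ H.card * (Measure.pi fun _ : F =>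
          rowNoise σ S).real ((fun u => u + fun _ => (1, v)) ⁻¹' T) ≤
        Real.exp ε * (Measure.pi fun _ : F => rowNoise σ S).real T + δ := by
  set ν := Measure.pi fun _ : F => rowNoise σ S
  have hlim := tendsto_real_inter_releaseSet (τs := τs) ν id T
  have hlim' := tendsto_real_inter_releaseSet (τs := τs) ν (fun u => u + fun _ => (1, v))
    ((fun u => u + fun _ => (1, v)) ⁻¹' T)
  have key (n : ℕ) (hn : τ ≤ n) :
      ν.real (T ∩ id ⁻¹' releaseSet F k τs n) ≤ Real.exp ε * (Phi ((τs - τ) / σ) ^ H.card *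
        ν.real ((fun u => u + fun _ => (1, v)) ⁻¹' T ∩
          (fun u => u + fun _ => (1, v)) ⁻¹' releaseSet F k τs n)) + δ ∧
      1 - Phi ((τs - τ) / σ) ^ H.card + Phi ((τs - τ) / σ) ^ H.card *
        ν.real ((fun u => u + fun _ => (1, v)) ⁻¹' T ∩
          (fun u => u + fun _ => (1, v)) ⁻¹' releaseSet F k τs n) ≤
        Real.exp ε * ν.real (T ∩ id ⁻¹' releaseSet F k τs n) + δ := by
    obtain ⟨T', hT', hpre⟩ := exists_rows_preimage_eq (τs := τs) hn ((n : ℝ) • v) hT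
    have := h.threshold_rows hτ hσ hd hcard hn hT'
    rw [pi_map_row_eq_shift (c := fun _ : F => n) (c' := fun _ : F => n + 1) (fun _ => hn)
      (fun _ => hn.trans (Nat.le_succ n)) (fun _ => (n : ℝ) • v)
      (fun _ => ((n + 1 : ℕ) : ℝ) • v), pi_map_row (fun _ : F => n) (fun _ => (n : ℝ) • v),
      map_measureReal_apply (measurable_rows _ _ _ _) hT',
      map_measureReal_apply (measurable_rows _ _ _ _) hT', hpre,
      map_measureReal_apply (by fun_prop) (hT.inter (measurableSet_releaseSet F k τs n))] at this
    -- The shift between `n` and `n + 1` records does not depend on `n`, so the limit can be taken.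
    have hw : (fun _ : F => (((n + 1 : ℕ) : ℝ) - n, ((n + 1 : ℕ) : ℝ) • v - (n : ℝ) • v)) =
        fun _ => (1, v) := by
      funext _
      rw [← sub_smul]
      simp
    rw [hw] at this
    exact this
  constructor
  · refine le_of_tendsto_of_tendsto hlim (((hlim'.const_mul _).const_mul _).add_const δ)
      (Filter.eventually_atTop.2 ⟨τ, fun n hn => (key n hn).1⟩)
  · refine le_of_tendsto_of_tendsto ((hlim'.const_mul _).const_add _)
      ((hlim.const_mul _).add_const δ)
      (Filter.eventually_atTop.2 ⟨τ, fun n hn => (key n hn).2⟩)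

/-- A pair `(p, e)` is realised by splitting `Cu` groups into `F` and `H`. All noise shifts on `F`
equal `(1, v)`, of total squared norm `mu σ μ₀ p ^ 2`, so the optimal event for that shift gives the
exact term. -/
theorem le_of_isDP_sumAggregation [Infinite U] [Nonempty O] (hτ : 1 ≤ τ) (hσ : 0 < σ)
    (hS : S.PosDef) (hG : (Cu : ℕ∞) ≤ ENat.card G) {μ₀ ε δ : ℝ} {v : EuclideanSpace ℝ (Fin k)}
    (hv : dotProduct v.ofLp (S⁻¹.mulVec v.ofLp) = μ₀ ^ 2)
    (h : IsDP ε δ (fun X : Dataset U G O Cu => mechanism τ τs σ S (sumAggregation U G O v) X))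
    {t : ℝ} (ht : t ∈ deltaTerms τ τs σ μ₀ Cu ε) : t ≤ δ := by
  classical
  obtain ⟨D, hD⟩ := exists_finset_card_eq hG
  have hsplit {p e : ℕ} (hpe : p + e = Cu) :
      ∃ F H : Finset G, Disjoint F H ∧ F.card = p ∧ H.card = e := by
    obtain ⟨F, hFD, hF⟩ := Finset.exists_subset_card_eq (s := D) (n := p) (by omega)
    refine ⟨F, D \ F, Finset.disjoint_sdiff, hF, ?_⟩
    rw [Finset.card_sdiff_of_subset hFD]
    omega
  have hself {F : Finset G} {p : ℕ} (hF : F.card = p) :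
      rowsDual σ S (fun _ : F => ((1 : ℝ), v)) (fun _ => (1, v)) = mu σ μ₀ p ^ 2 := by
    rw [rowsDual_apply_self, mu, Real.sq_sqrt (by positivity)]
    simp [hv, hF]
    ring
  have hr0 := Phi_pos ((τs - τ) / σ)
  rcases ht with (rfl | ⟨p, e, hpe, hp, rfl⟩) | ⟨p, e, hpe, hp, rfl⟩
  -- All groups cross the threshold; the event is that some row is released.
  · obtain ⟨F, H, hd, hF, hH⟩ := hsplit (zero_add Cu)
    have := (h.gaussian_rows hτ hσ hd (by omega) (T := ∅) MeasurableSet.empty).2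
    simpa [hH, deltaInfinite] using this
  · obtain ⟨F, H, hd, hF, hH⟩ := hsplit hpe
    obtain ⟨T, hT, hf⟩ := (cameronMartin_pi_rowNoise hσ hS
      (fun _ : F => ((1 : ℝ), v))).exists_real_sub_eq (mu_pos hσ μ₀ hp) (hself hF)
      (eps2 τ τs σ ε e)
    have := (h.gaussian_rows hτ hσ hd (by omega) hT).2
    rw [hH] at this
    rw [hf, mul_sub, ← mul_assoc, exp_eps2]
    linarith
  · obtain ⟨F, H, hd, hF, hH⟩ := hsplit hpe
    -- In this direction the smaller dataset is the shifted one, so the optimal event is taken for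
    -- `-(1, v)` and translated back.
    obtain ⟨T, hT, hf⟩ := (cameronMartin_pi_rowNoise hσ hS
      (fun _ : F => ((1 : ℝ), v))).neg.exists_real_sub_eq (mu_pos hσ μ₀ hp)
      (by simpa using hself hF) (eps3 τ τs σ ε e)
    have := (h.gaussian_rows hτ hσ hd (by omega)
      (T := (fun u => u + -fun _ => (1, v)) ⁻¹' T) (hT.preimage (by fun_prop))).1
    rw [← Set.preimage_comp] at this
    have hid : ((fun u => u + -fun _ => (1, v)) ∘ fun u => u + fun _ => (1, v) :
        (F → ℝ × EuclideanSpace ℝ (Fin k)) → _) = id := by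
      funext u
      simp
    rw [hid, Set.preimage_id, hH, ← mul_assoc, ← exp_eps3] at this
    rw [hf]
    linarith

end LowerBound

/-! ### Comparison with `deltaInfinite` and `deltaGaussian`. -/

section DeltaTerms

variable {τ Cu : ℕ} {τs σ μ₀ ε : ℝ}

theorem finite_deltaTerms : (deltaTerms τ τs σ μ₀ Cu ε).Finite := by
  have hfin (g : ℕ → ℕ → ℝ) : {t | ∃ p e : ℕ, p + e = Cu ∧ 0 < p ∧ t = g p e}.Finite := by
    refine ((Finset.HasAntidiagonal.antidiagonal Cu).finite_toSet.image fun q => g q.1 q.2).subset ?_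
    rintro _ ⟨p, e, hpe, -, rfl⟩
    exact ⟨(p, e), by simpa using hpe, rfl⟩
  exact ((Set.finite_singleton _).union (hfin _)).union (hfin _)

theorem exists_isGreatest_deltaTerms : ∃ δ, IsGreatest (deltaTerms τ τs σ μ₀ Cu ε) δ :=
  finite_deltaTerms.isCompact.exists_isGreatest ⟨_, Or.inl (Or.inl rfl)⟩

theorem le_one_of_mem_deltaTerms {t : ℝ} (ht : t ∈ deltaTerms τ τs σ μ₀ Cu ε) : t ≤ 1 := by
  have hr0 := Phi_pos ((τs - τ) / σ)
  rcases ht with (rfl | ⟨p, e, -, -, rfl⟩) | ⟨p, e, -, -, rfl⟩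
  · rw [deltaInfinite]
    linarith [pow_pos hr0 Cu]
  · have := mul_le_of_le_one_right (pow_pos hr0 e).le (f_le_one (mu σ μ₀ p) (eps2 τ τs σ ε e))
    linarith
  · exact f_le_one _ _

theorem deltaGaussian_mem_deltaTerms (hCu : 1 ≤ Cu) :
    deltaGaussian σ μ₀ Cu ε ∈ deltaTerms τ τs σ μ₀ Cu ε :=
  Or.inr ⟨Cu, 0, add_zero Cu, hCu, by simp [deltaGaussian, eps3]⟩

/-- Each Gaussian term is at most `1 - r ^ e` plus `deltaGaussian`, and `e < Cu` since `p > 0`, so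
`1 - r ^ e` is strictly below `deltaInfinite`. For `deltaInfinite` itself strictness comes from
`f_pos`. -/
theorem lt_add_of_mem_deltaTerms (hCu : 1 ≤ Cu) (hσ : 0 < σ) {t : ℝ}
    (ht : t ∈ deltaTerms τ τs σ μ₀ Cu ε) :
    t < deltaInfinite τ τs σ Cu + deltaGaussian σ μ₀ Cu ε := by
  have hr0 := Phi_pos ((τs - τ) / σ)
  have hr1 := Phi_lt_one ((τs - τ) / σ)
  set r := Phi ((τs - τ) / σ) with hr
  have hlt {p e : ℕ} (hpe : p + e = Cu) (hp : 0 < p) : r ^ Cu < r ^ e :=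
    pow_lt_pow_right_of_lt_one₀ hr0 hr1 (by omega)
  rcases ht with (rfl | ⟨p, e, hpe, hp, rfl⟩) | ⟨p, e, hpe, hp, rfl⟩
  · exact lt_add_of_pos_right _ (f_pos (mu_pos hσ μ₀ hCu) ε)
  · have hmu := mu_pos hσ μ₀ hp
    have hre1 : r ^ e ≤ 1 := pow_le_one₀ hr0.le hr1.le
    have heps : ε ≤ eps2 τ τs σ ε e := by
      have := mul_nonneg (Nat.cast_nonneg (α := ℝ) e) (neg_nonneg.2 (Real.log_nonpos hr0.le hr1.le))
      rw [eps2]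
      linarith
    have h1 : r ^ e * f (mu σ μ₀ p) (eps2 τ τs σ ε e) ≤ f (mu σ μ₀ p) (eps2 τ τs σ ε e) :=
      mul_le_of_le_one_left (f_nonneg hmu _) hre1
    have h2 := f_anti_right hmu heps
    have h3 := f_mono_left hmu (mu_mono hσ μ₀ (show p ≤ Cu by omega)) ε
    rw [deltaInfinite, deltaGaussian]
    linarith [hlt hpe hp]
  · have hmu := mu_pos hσ μ₀ hp
    have h1 := f_add_log_le hmu ε (pow_pos hr0 e) (pow_le_one₀ hr0.le hr1.le)
    rw [Real.log_pow] at h1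
    have h3 := f_mono_left hmu (mu_mono hσ μ₀ (show p ≤ Cu by omega)) ε
    rw [deltaInfinite, deltaGaussian, eps3]
    linarith [hlt hpe hp]

/-- The only pair is `(1, 0)`, at which both families reduce to `deltaGaussian`. -/
theorem le_max_of_mem_deltaTerms_one {t : ℝ} (ht : t ∈ deltaTerms τ τs σ μ₀ 1 ε) :
    t ≤ max (deltaInfinite τ τs σ 1) (deltaGaussian σ μ₀ 1 ε) := by
  rcases ht with (rfl | ⟨p, e, hpe, hp, rfl⟩) | ⟨p, e, hpe, hp, rfl⟩
  · exact le_max_left _ _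
  all_goals
    obtain ⟨rfl, rfl⟩ : p = 1 ∧ e = 0 := by omega
    refine le_max_of_le_right (le_of_eq ?_)
    simp [deltaGaussian, eps2, eps3]

end DeltaTerms

end GSHM

theorem mainTheorem2
    {U G O : Type*} [Infinite U] [Nonempty O]
    (Cu k τ : ℕ) (hCu : 1 ≤ Cu) (hG : (Cu : ℕ∞) ≤ ENat.card G) (hτ : 1 ≤ τ)
    (τs σ : ℝ) (hτs : (τ : ℝ) < τs) (hσ : 0 < σ)
    (S : Matrix (Fin k) (Fin k) ℝ) (hS : S.PosDef)
    (μ₀ : ℝ) (hμ₀ : 0 ≤ μ₀) (hk : k = 0 → μ₀ = 0)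
    (ε : ℝ) (hε : 0 ≤ ε) :
    ∃ δ : ℝ,
      IsGreatest (GSHM.deltaTerms τ τs σ μ₀ Cu ε) δ ∧
      IsLeast {δ' : ℝ | ∀ A : GSHM.Aggregation U G O k, GSHM.HasSensitivity Cu S A μ₀ →
        GSHM.IsDP ε δ'
          (fun X : GSHM.Dataset U G O Cu => GSHM.mechanism τ τs σ S A X)} δ ∧
      max (GSHM.deltaInfinite τ τs σ Cu) (GSHM.deltaGaussian σ μ₀ Cu ε) ≤ δ ∧
      δ < GSHM.deltaInfinite τ τs σ Cu + GSHM.deltaGaussian σ μ₀ Cu ε ∧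
      (Cu = 1 → δ = max (GSHM.deltaInfinite τ τs σ Cu) (GSHM.deltaGaussian σ μ₀ Cu ε)) := by
  obtain ⟨δ, hδ⟩ := GSHM.exists_isGreatest_deltaTerms
    (τ := τ) (Cu := Cu) (τs := τs) (σ := σ) (μ₀ := μ₀) (ε := ε)
  have hmax : max (GSHM.deltaInfinite τ τs σ Cu) (GSHM.deltaGaussian σ μ₀ Cu ε) ≤ δ :=
    max_le (hδ.2 (Or.inl (Or.inl rfl))) (hδ.2 (GSHM.deltaGaussian_mem_deltaTerms hCu))
  refine ⟨δ, hδ, ⟨fun A hA => ?_, fun δ' hδ' => ?_⟩, hmax,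
    GSHM.lt_add_of_mem_deltaTerms hCu hσ hδ.1, ?_⟩
  · exact GSHM.isDP_mechanism hσ hS hε (fun t ht => hδ.2 ht)
      (GSHM.le_one_of_mem_deltaTerms hδ.1) hA
  -- One extremal aggregation function already forces every term, so minimality is tested on it
  -- alone.
  · obtain ⟨v, hv⟩ := GSHM.exists_quadForm_eq hS hk
    obtain ⟨D, hD⟩ := GSHM.exists_finset_card_eq hG
    have : Nonempty G := (Finset.card_pos.1 (hCu.trans_eq hD.symm)).to_type
    exact GSHM.le_of_isDP_sumAggregation hτ hσ hS hG hv
      (hδ' _ (GSHM.hasSensitivity_sumAggregation hCu hμ₀ hv)) hδ.1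
  · rintro rfl
    exact le_antisymm (GSHM.le_max_of_mem_deltaTerms_one hδ.1) hmax
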